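/- Let $n\ge 0$ be an integer, let $\Sigma$ be a finite set of signs, and let $<$ be any total order on $\Sigma$. Put $[[n]]=\{1,\bar 1,\dots,n,\bar n\}$, with the involution $i\leftrightarrow\bar i$, and $\overline X=\{\bar x : x\in X\}$ for $X\subseteq[[n]]$. A *$\Sigma$-labeled partition* of $[[n]]$ is a partition $x$ of $[[n]]$ into non-empty blocks, together with an injection from a subset of its blocks (the *signed* blocks) to $\Sigma$, such that $R\in x$ implies $\overline R\in x$, and a block $R\in x$ is signed if and only if $R=\overline R$. Write $\Sigma(x)\subseteq\Sigma$ for the set of signs that occur, and $x_\sigma$ for the block of sign $\sigma$ (with $x_\sigma=\emptyset$ if $\sigma\notin\Sigma(x)$). Set $x\preceq y$ if $\sigma\in\Sigma(y)$ and $x_\sigma\subseteq y_\sigma$ for every $\sigma\in\Sigma(x)$, and for every unsigned block $R$ of $x$ there is a block $T$ of $y$ with $R\subseteq T$ and $\overline R\subseteq\overline T$. Let $\Pi_{n,\Sigma}$ be the poset of all $\Sigma$-labeled partitions of $[[n]]$ with a new top element $\hat 1$ adjoined; its least element $\hat 0$ is the partition into singletons. For a block $R$, its *representative* $r(R)$ is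 the least $i\in\{1,\dots,n\}$ with $i\in R$ or $\bar i\in R$; the block $R$ is *normalized* if $r(R)\in R$. A covering pair (edge) $x\prec\!\cdot\, y$ of $\Pi_{n,\Sigma}$ with $y\ne\hat 1$ is *coherent* if $R\cup R'\in y$ for some distinct normalized unsigned blocks $R,R'$ of $x$; *non-coherent* if $R\cup\overline{R'}\in y$ for some distinct normalized unsigned blocks $R,R'$ of $x$; and *of sign $\sigma$* if $x_\sigma\subsetneq y_\sigma$. Define an edge labeling $\lambda$ of $\Pi_{n,\Sigma}$ with values in $\mathbb N\times\mathbb N$, ordered lexicographically, by $$\lambda(x\prec\!\cdot\, y)=\begin{cases} (0,\max(r(R),r(R'))) & \text{if the edge is coherent, with } R,R' \text{ as above},\\ (2,\min(r(R),r(R'))) & \text{if the edge is non-coherent, with } R,R' \text{ as above},\\ (1,|\{\tau\in\Sigma(x):\tau\le\sigma\}|) & \text{if the edge is of sign }\sigma\in\Sigma(x),\\ (1,|\{\tau\in\Sigma:\tau\le\sigma\}\cup\Sigma(x)|) & \text{if the edge is of sign }\sigma\notin\Sigma(x),\\ (1,2) & \text{if } y=\hat 1. \end{cases}$$ **Theorem.**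 The labeling $\lambda$ is an EL-labeling of the bounded poset $\Pi_{n,\Sigma}$. That is, for all $x\preceq y$ in $\Pi_{n,\Sigma}$, among the maximal chains $x\prec\!\cdot\, z_1\prec\!\cdot\,\cdots\prec\!\cdot\, z_t\prec\!\cdot\, y$ of the closed interval $[x,y]$ there is exactly one whose word of labels is strictly increasing, and its word is lexicographically strictly smaller than the word of every other maximal chain of $[x,y]$. -/

import Mathlib

namespace LabeledPartitions

section EdgeLabelings

variable {P : Type*} [PartialOrder P]

/-- A map from the edges `x ⋖ y` of the Hasse diagram of `P` to `Λ`. -/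
def EdgeLabeling (P : Type*) [PartialOrder P] (Λ : Type*) : Type _ :=
  ∀ x y : P, x ⋖ y → Λ

/-- `MaximalChain x y` is the type of maximal chains `x ⋖ z₁ ⋖ ⋯ ⋖ z_t ⋖ y` of the closed
interval `[x, y]`. -/
inductive MaximalChain : P → P → Type _
  | nil (x : P) : MaximalChain x x
  | cons {x z y : P} (h : x ⋖ z) (c : MaximalChain z y) : MaximalChain x y

/-- The word of labels read along a maximal chain of an interval. -/
def MaximalChain.word {Λ : Type*} (lam : EdgeLabeling P Λ) :
    {x y : P} → MaximalChain x y → List Λ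
  | _, _, .nil _ => []
  | _, _, .cons h c => lam _ _ h :: c.word lam

/-- A maximal chain is increasing if its word is strictly increasing. -/
def MaximalChain.IsIncreasing {Λ : Type*} [PartialOrder Λ] (lam : EdgeLabeling P Λ) {x y : P}
    (c : MaximalChain x y) : Prop :=
  (c.word lam).Pairwise (· < ·)

/-- EL-labelings of a bounded poset: every closed interval has a unique increasing maximal
chain, and this chain lexicographically precedes all other maximal chains of the interval. -/
def IsELLabeling [BoundedOrder P] {Λ : Type*} [PartialOrder Λ] (lam : EdgeLabeling P Λ) : Prop :=
  ∀ x y : P, x ≤ y → ∃ c : MaximalChain x y,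
    c.IsIncreasing lam ∧
    (∀ d : MaximalChain x y, d.IsIncreasing lam → d = c) ∧
    ∀ d : MaximalChain x y, d ≠ c → List.Lex (· < ·) (c.word lam) (d.word lam)

end EdgeLabelings

/-- The set `[[n]] = {1, 1̄, …, n, n̄}`: the pair `(i, false)` is the number `i + 1` of
`{1, …, n}`, and `(i, true)` is its barred copy. -/
abbrev Ground (n : ℕ) : Type := Fin n × Bool

/-- The involution `i ↦ i̅`, `i̅ ↦ i`. -/
def bar {n : ℕ} (a : Ground n) : Ground n := (a.1, !a.2)

/-- `B̅ = {b̅ | b ∈ B}`. -/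
def barSet {n : ℕ} (B : Finset (Ground n)) : Finset (Ground n) := B.image bar

/-- A `Σ`-labeled partition of `[[n]]` (with `S` in the role of `Σ`). The signed blocks are the
blocks `B` with `sign B = some σ`, and then `σ` is the sign of `B`; the sign is an injective
function on the set of signed blocks. -/
@[ext]
structure LabeledPartition (n : ℕ) (S : Type*) where
  /-- the underlying partition of `[[n]]` into non-empty blocks -/
  partition : Finpartition (Finset.univ : Finset (Ground n))
  /-- the sign of a signed block; `none` on unsigned blocks and on sets that are not blocks -/
  sign : Finset (Ground n) → Option S
  mem_of_sign : ∀ B σ, sign B = some σ → B ∈ partition.parts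
  sign_injective : ∀ B C σ, sign B = some σ → sign C = some σ → B = C
  bar_mem : ∀ B ∈ partition.parts, barSet B ∈ partition.parts
  bar_eq_iff : ∀ B ∈ partition.parts, barSet B = B ↔ ∃ σ, sign B = some σ

namespace LabeledPartition

variable {n : ℕ} {S : Type*}

/-- `R` is an unsigned block of `x`. -/
def IsUnsignedBlock (x : LabeledPartition n S) (R : Finset (Ground n)) : Prop :=
  R ∈ x.partition.parts ∧ x.sign R = none

/-- `σ ∈ Σ(x)`: some block of `x` has sign `σ`. -/
def HasSign (x : LabeledPartition n S) (σ : S) : Prop := ∃ B, x.sign B = some σ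

open Classical in
/-- `x_σ`: the block of `x` of sign `σ`, or `∅` if `x` has no block of sign `σ`. -/
noncomputable def signedBlock (x : LabeledPartition n S) (σ : S) : Finset (Ground n) :=
  if h : x.HasSign σ then h.choose else ∅

theorem signedBlock_eq (x : LabeledPartition n S) {σ : S} {B : Finset (Ground n)}
    (h : x.sign B = some σ) : x.signedBlock σ = B := by
  have h' : x.HasSign σ := ⟨B, h⟩
  rw [signedBlock, dif_pos h']
  exact x.sign_injective _ _ σ h'.choose_spec h

theorem sign_signedBlock (x : LabeledPartition n S) {σ : S} (h : x.HasSign σ) :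
    x.sign (x.signedBlock σ) = some σ := by
  obtain ⟨B, hB⟩ := h
  rwa [x.signedBlock_eq hB]

/-- The refinement relation: every signed block of `x` lies in the block of `y` of the same
sign, and every pair `R`, `R̅` of unsigned blocks of `x` lies in a pair `T`, `T̅` of blocks
of `y`. -/
def Refines (x y : LabeledPartition n S) : Prop :=
  (∀ σ, x.HasSign σ → y.HasSign σ ∧ x.signedBlock σ ⊆ y.signedBlock σ) ∧
  ∀ R, x.IsUnsignedBlock R → ∃ T ∈ y.partition.parts, R ⊆ T ∧ barSet R ⊆ barSet T

theorem Refines.partition_le {x y : LabeledPartition n S} (h : x.Refines y) :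
    x.partition ≤ y.partition := by
  intro B hB
  cases hs : x.sign B with
  | none =>
    obtain ⟨T, hT, hBT, _⟩ := h.2 B ⟨hB, hs⟩
    exact ⟨T, hT, hBT⟩
  | some σ =>
    obtain ⟨hy, hsub⟩ := h.1 σ ⟨B, hs⟩
    rw [x.signedBlock_eq hs] at hsub
    exact ⟨_, y.mem_of_sign _ σ (y.sign_signedBlock hy), hsub⟩

theorem Refines.sign_eq {x y : LabeledPartition n S} (h : x.Refines y)
    (hp : x.partition = y.partition) {B : Finset (Ground n)} {σ : S} (hB : x.sign B = some σ) :
    y.sign B = some σ := by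
  obtain ⟨hy, hsub⟩ := h.1 σ ⟨B, hB⟩
  rw [x.signedBlock_eq hB] at hsub
  have hC := y.sign_signedBlock hy
  have hBm : B ∈ y.partition.parts := hp ▸ x.mem_of_sign B σ hB
  obtain ⟨a, ha⟩ := y.partition.nonempty_of_mem_parts hBm
  rw [y.partition.eq_of_mem_parts hBm (y.mem_of_sign _ σ hC) ha (hsub ha)]
  exact hC

instance : PartialOrder (LabeledPartition n S) where
  le := Refines
  le_refl x := ⟨fun _ h => ⟨h, subset_rfl⟩, fun R hR => ⟨R, hR.1, subset_rfl, subset_rfl⟩⟩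
  le_trans x y z hxy hyz := by
    refine ⟨fun σ h => ⟨(hyz.1 σ (hxy.1 σ h).1).1,
      (hxy.1 σ h).2.trans (hyz.1 σ (hxy.1 σ h).1).2⟩, fun R hR => ?_⟩
    obtain ⟨T, hT, hRT, -⟩ := hxy.2 R hR
    obtain ⟨U, hU, hTU⟩ := Refines.partition_le hyz hT
    exact ⟨U, hU, hRT.trans hTU, Finset.image_subset_image (hRT.trans hTU)⟩
  le_antisymm x y hxy hyx := by
    have hp : x.partition = y.partition :=
      le_antisymm (Refines.partition_le hxy) (Refines.partition_le hyx)
    refine LabeledPartition.ext hp (funext fun B => Option.ext fun σ => ?_)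
    exact ⟨fun h => Refines.sign_eq hxy hp h, fun h => Refines.sign_eq hyx hp.symm h⟩

/-- The finest partition `1 | 1̄ | ⋯ | n | n̄`, without signed blocks. -/
instance : OrderBot (LabeledPartition n S) where
  bot :=
    { partition := ⊥
      sign := fun _ => none
      mem_of_sign := by simp
      sign_injective := by simp
      bar_mem := by
        intro B hB
        obtain ⟨a, -, rfl⟩ := Finpartition.mem_bot_iff.1 hB
        exact Finpartition.mem_bot_iff.2 ⟨bar a, Finset.mem_univ _, by simp [barSet]⟩
      bar_eq_iff := by
        intro B hB
        obtain ⟨a, -, rfl⟩ := Finpartition.mem_bot_iff.1 hB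
        simp [barSet, bar, Prod.ext_iff] }
  bot_le x := by
    refine ⟨fun σ h => ?_, fun R hR => ?_⟩
    · obtain ⟨B, hB⟩ := h
      simp at hB
    · obtain ⟨U, hU, hRU⟩ := (bot_le : ⊥ ≤ x.partition) hR.1
      exact ⟨U, hU, hRU, Finset.image_subset_image hRU⟩

end LabeledPartition

/-- The poset `Π_{n,Σ}`: all `Σ`-labeled partitions of `[[n]]`, with a new top element. -/
abbrev PiPoset (n : ℕ) (S : Type*) : Type _ := WithTop (LabeledPartition n S)

/-- The representative of a block: the least `i ∈ {1, …, n}` such that `i` or `i̅` lies in it. -/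
noncomputable def rep {n : ℕ} (B : Finset (Ground n)) : ℕ :=
  sInf {k : ℕ | ∃ a ∈ B, (a.1 : ℕ) + 1 = k}

/-- A block is normalized if its representative belongs to it. -/
def IsNormalized {n : ℕ} (B : Finset (Ground n)) : Prop :=
  ∃ i : Fin n, (i : ℕ) + 1 = rep B ∧ (i, false) ∈ B

namespace LabeledPartition

variable {n : ℕ} {S : Type*}

/-- `R` and `R'` are two distinct normalized unsigned blocks of `x`. -/
def IsNormalizedPair (x : LabeledPartition n S) (R R' : Finset (Ground n)) : Prop :=
  R ≠ R' ∧ x.IsUnsignedBlock R ∧ IsNormalized R ∧ x.IsUnsignedBlock R' ∧ IsNormalized R'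

/-- The pair `p = (R, R')` witnesses that the edge from `x` to `y` is coherent. -/
def IsCoherentPair (x y : LabeledPartition n S)
    (p : Finset (Ground n) × Finset (Ground n)) : Prop :=
  x.IsNormalizedPair p.1 p.2 ∧ p.1 ∪ p.2 ∈ y.partition.parts

/-- The pair `p = (R, R')` witnesses that the edge from `x` to `y` is non-coherent. -/
def IsNonCoherentPair (x y : LabeledPartition n S)
    (p : Finset (Ground n) × Finset (Ground n)) : Prop :=
  x.IsNormalizedPair p.1 p.2 ∧ p.1 ∪ barSet p.2 ∈ y.partition.parts

/-- The edge from `x` to `y` is of sign `σ`. -/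
def IsOfSign (x y : LabeledPartition n S) (σ : S) : Prop :=
  x.signedBlock σ ⊂ y.signedBlock σ

open Classical in
/-- The second component of the label of an edge of sign `σ` starting at `x`:
`|Σ(x)_{≤ σ}|` if `σ ∈ Σ(x)`, and `|Σ_{≤ σ} ∪ Σ(x)|` otherwise. -/
noncomputable def signIndex [Fintype S] [LinearOrder S] (x : LabeledPartition n S) (σ : S) : ℕ :=
  if x.HasSign σ then (Finset.univ.filter fun τ => x.HasSign τ ∧ τ ≤ σ).card
  else (Finset.univ.filter fun τ => τ ≤ σ ∨ x.HasSign τ).card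

open Classical in
/-- The label of an edge from `x` to `y`, both different from the top element. Every such edge is
of exactly one of the three types (with a unique sign, or with a pair `R`, `R'` that is unique up
to order), so that the choices do not matter and the last line is never used. -/
noncomputable def label [Fintype S] [LinearOrder S] (x y : LabeledPartition n S) : ℕ ×ₗ ℕ :=
  if h : ∃ p, IsCoherentPair x y p then toLex (0, max (rep h.choose.1) (rep h.choose.2))
  else if h : ∃ p, IsNonCoherentPair x y p then toLex (2, min (rep h.choose.1) (rep h.choose.2))
  else if h : ∃ σ, IsOfSign x y σ then toLex (1, signIndex x h.choose)
  else toLex (0, 0)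

end LabeledPartition

/-- The edge labeling `λ` of `Π_{n,Σ}`, with the labels ordered lexicographically. -/
noncomputable def edgeLabeling (n : ℕ) (S : Type*) [Fintype S] [LinearOrder S] :
    EdgeLabeling (PiPoset n S) (ℕ ×ₗ ℕ)
  | WithTop.some x, WithTop.some y, _ => x.label y
  | _, _, _ => toLex (1, 2)

end LabeledPartitions

/-! By induction from above, it suffices to find in every interval `[x, y]` one atom whose label is
smaller than those of the other atoms and of the edges that follow it, such that every other atom is
followed by an edge of no larger label (`isELLabeling_of_local`).

To find this atom, a labeled partition is encoded as a map on `[[n]]` (`NormalForm`): an element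
goes to the sign of its block or, if the block is unsigned, to the block's element of least absolute
value. Such maps commute with the bar, `x ≤ y` means that `y` factors through `x`, and the edges
below the top are exactly the substitutions `move j t` of a root `j` by a sign or by a smaller root,
barred or not. This lies below `y` iff `y` identifies `j` with `t`. The admissible moves after `move
j t` are those admissible before that do not involve `j`, so moves at different steps can be
compared at `x`.

The required atom is the admissible move of least label. It is unique, since two moves with the same
label produce a coherent move of smaller label (`lt_moveLabel_of_ne`). The labels that follow are
larger, because those moves were already available at `x` and inserting a sign preserves the
comparison of ranks. After any other move `j ↦ t`, either the least move is still available, or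
combining the identifications made by both moves gives an edge of no larger label; the exceptional
cases end with an edge to the top, whose label `(1, 2)` is then small enough
(`exists_isAdmissible_move_le`). -/

namespace LabeledPartitions

/-! ### A local criterion for EL-labelings. -/

section Criterion

variable {P : Type*} [PartialOrder P]

theorem MaximalChain.le {x y : P} (c : MaximalChain x y) : x ≤ y := by
  induction c with
  | nil => exact le_rfl
  | cons h _ ih => exact h.le.trans ih

theorem MaximalChain.eq_nil {x : P} (c : MaximalChain x x) : c = .nil x := by
  cases c with
  | nil => rfl
  | cons h c => exact absurd (h.lt.trans_le c.le) (lt_irrefl _)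

theorem MaximalChain.IsIncreasing.of_cons {Λ : Type*} [PartialOrder Λ] {lam : EdgeLabeling P Λ}
    {x z y : P} {h : x ⋖ z} {c : MaximalChain z y} (hc : (MaximalChain.cons h c).IsIncreasing lam) :
    c.IsIncreasing lam :=
  (List.pairwise_cons.1 hc).2

theorem MaximalChain.IsIncreasing.cons {Λ : Type*} [PartialOrder Λ] {lam : EdgeLabeling P Λ}
    {x z y : P} (h : x ⋖ z) {c : MaximalChain z y} (hc : c.IsIncreasing lam)
    (hlt : ∀ w (hw : z ⋖ w), w ≤ y → lam x z h < lam z w hw) :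
    (MaximalChain.cons h c).IsIncreasing lam := by
  refine List.pairwise_cons.2 ⟨?_, hc⟩
  cases c with
  | nil => simp [word]
  | cons hw c =>
    intro l hl
    rcases List.mem_cons.1 hl with rfl | hl
    · exact hlt _ hw c.le
    · exact (hlt _ hw c.le).trans ((List.pairwise_cons.1 hc).1 l hl)

/-- A local criterion for EL-labelings: in every interval `[x, y]` some atom `a` has a label that
is smaller than the labels of the other atoms and than the labels of the edges that follow it,
while every other atom is followed by some edge which does not increase the label. -/
theorem isELLabeling_of_local [BoundedOrder P] [Finite P] {Λ : Type*} [PartialOrder Λ]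
    (lam : EdgeLabeling P Λ)
    (H : ∀ x y : P, x < y → ∃ (a : P) (ha : x ⋖ a), a ≤ y ∧
      (∀ w (hw : a ⋖ w), w ≤ y → lam x a ha < lam a w hw) ∧
      ∀ z (hz : x ⋖ z), z ≤ y → z ≠ a → lam x a ha < lam x z hz ∧
        ∃ (w : P) (hw : z ⋖ w), w ≤ y ∧ lam z w hw ≤ lam x z hz) :
    IsELLabeling lam := by
  intro x y
  induction x using WellFoundedGT.induction with
  | ind x ih =>
  intro hxy
  rcases hxy.eq_or_lt with rfl | hlt
  · exact ⟨.nil x, by simp [MaximalChain.IsIncreasing, MaximalChain.word],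
      fun d _ => d.eq_nil, fun d hd => absurd d.eq_nil hd⟩
  obtain ⟨a, ha, hay, hafter, hother⟩ := H x y hlt
  obtain ⟨c, hc, hcu, hcl⟩ := ih a ha.lt hay
  refine ⟨.cons ha c, hc.cons ha hafter, fun d hd => ?_, fun d hd => ?_⟩
  · cases d with
    | nil => exact absurd hlt (lt_irrefl _)
    | @cons _ z _ hz d =>
      by_cases hza : z = a
      · subst hza
        rw [hcu d hd.of_cons]
      obtain ⟨-, w, hw, hwy, hle⟩ := hother z hz d.le hza
      obtain ⟨c', hc', hcu', hcl'⟩ := ih z hz.lt d.le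
      obtain ⟨e, -⟩ := ih w (hz.lt.trans hw.lt) hwy
      -- The tail of an increasing chain is the lexicographically least chain of `[z, y]`.
      -- Comparison with a chain through `w` bounds its first label by that of `z ⋖ w`, hence by
      -- that of `x ⋖ z`: the chain does not increase at `z`.
      obtain rfl := hcu' d hd.of_cons
      exfalso
      have hhead := (List.pairwise_cons.1 hd).1
      by_cases hed : MaximalChain.cons hw e = d
      · subst hed
        exact absurd ((hhead _ (List.mem_cons_self ..)).trans_le hle) (lt_irrefl _)
      · have hlex := hcl' _ hed
        cases d with
        | nil => exact absurd (hw.lt.trans_le hwy) (lt_irrefl _)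
        | cons hv d =>
          have h1 := hhead _ (List.mem_cons_self ..)
          simp only [MaximalChain.word] at hlex
          rcases List.cons_lex_cons_iff.1 hlex with h2 | ⟨h2, -⟩
          · exact absurd ((h1.trans h2).trans_le hle) (lt_irrefl _)
          · exact absurd ((h1.trans_eq h2).trans_le hle) (lt_irrefl _)
  · cases d with
    | nil => exact absurd hlt (lt_irrefl _)
    | @cons _ z _ hz d =>
      by_cases hza : z = a
      · subst hza
        exact List.Lex.cons (hcl d fun h => hd (by rw [h]))
      · exact List.Lex.rel (hother z hz d.le hza).1

end Criterion

/-! ### Ranks of signs, with the signs already in use listed first. -/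

section SignRank

theorem insert_pred_eq {S : Type*} {p : S → Prop} {σ : S} (h : p σ) : (fun τ => p τ ∨ τ = σ) = p := by
  funext τ
  exact propext ⟨fun h' => h'.elim id fun e => e ▸ h, Or.inl⟩

variable {S : Type*} [Fintype S] [LinearOrder S]

open Classical in
/-- The position of the sign `σ` when the signs in `p` are listed before all other signs. -/
noncomputable def signRank (p : S → Prop) (σ : S) : ℕ :=
  if p σ then (Finset.univ.filter fun τ => p τ ∧ τ ≤ σ).card
  else (Finset.univ.filter fun τ => τ ≤ σ ∨ p τ).card

theorem signRank_lt_of_lt {p : S → Prop} {σ τ : S} (h : p τ → p σ) (hlt : σ < τ) :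
    signRank p σ < signRank p τ := by
  classical
  unfold signRank
  by_cases hσ : p σ <;> by_cases hτ : p τ <;> simp only [hσ, hτ, if_true, if_false]
  · refine Finset.card_lt_card (Finset.ssubset_iff_of_subset ?_ |>.2 ⟨τ, ?_, ?_⟩)
    · intro a; simp only [Finset.mem_filter]; grind
    · simp [hτ]
    · simp [hlt]
  · refine Finset.card_lt_card (Finset.ssubset_iff_of_subset ?_ |>.2 ⟨τ, ?_, ?_⟩)
    · intro a; simp only [Finset.mem_filter]; grind
    · simp
    · simp [hlt]
  · exact absurd (h hτ) hσ
  · refine Finset.card_lt_card (Finset.ssubset_iff_of_subset ?_ |>.2 ⟨τ, ?_, ?_⟩)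
    · intro a; simp only [Finset.mem_filter]; grind
    · simp
    · simp [hlt, hτ]

theorem signRank_lt_of_not {p : S → Prop} {σ τ : S} (hσ : p σ) (hτ : ¬ p τ) :
    signRank p σ < signRank p τ := by
  classical
  unfold signRank
  simp only [hσ, hτ, if_true, if_false]
  refine Finset.card_lt_card (Finset.ssubset_iff_of_subset ?_ |>.2 ⟨τ, ?_, ?_⟩)
  · intro a; simp only [Finset.mem_filter]; grind
  · simp
  · simp [hτ]

theorem signRank_injective (p : S → Prop) : Function.Injective (signRank p) := by
  intro σ τ h
  by_contra hne
  by_cases hσ : p σ <;> by_cases hτ : p τ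
  · rcases lt_or_gt_of_ne hne with hlt | hlt
    · exact (signRank_lt_of_lt (fun _ => hσ) hlt).ne h
    · exact (signRank_lt_of_lt (fun _ => hτ) hlt).ne' h
  · exact (signRank_lt_of_not hσ hτ).ne h
  · exact (signRank_lt_of_not hτ hσ).ne' h
  · rcases lt_or_gt_of_ne hne with hlt | hlt
    · exact (signRank_lt_of_lt (fun h => absurd h hτ) hlt).ne h
    · exact (signRank_lt_of_lt (fun h => absurd h hσ) hlt).ne' h

/-- The rank of `τ` may grow when `σ` is inserted. But if `σ` is new, the signs then counted for `τ`
are among those counted for `σ` before the insertion. -/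
theorem signRank_insert_le {p : S → Prop} {σ τ : S} (h : signRank p τ ≤ signRank p σ) :
    signRank (fun ρ => p ρ ∨ ρ = σ) τ ≤ signRank p σ := by
  classical
  by_cases hσ : p σ
  · rwa [insert_pred_eq hσ]
  by_cases hτ : p τ ∨ τ = σ
  · simp only [signRank, hσ, hτ, if_true, if_false]
    refine Finset.card_le_card fun a => ?_
    simp only [Finset.mem_filter]
    grind
  · have hlt : τ < σ := by
      by_contra hlt
      have hne : τ ≠ σ := fun e => hτ (Or.inr e)
      exact absurd h (not_le.2 (signRank_lt_of_lt (fun h => absurd (Or.inl h) hτ)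
        (lt_of_le_of_ne (not_lt.1 hlt) hne.symm)))
    simp only [signRank, hσ, hτ, if_false]
    refine Finset.card_le_card fun a => ?_
    simp only [Finset.mem_filter]
    grind

/-- If `σ` is new, then so is `τ`, and it remains new after the insertion, which can only enlarge
the set counted for `τ`. -/
theorem lt_signRank_insert {p : S → Prop} {σ τ : S} (h : signRank p σ < signRank p τ) :
    signRank p σ < signRank (fun ρ => p ρ ∨ ρ = σ) τ := by
  classical
  by_cases hσ : p σ
  · rwa [insert_pred_eq hσ]
  by_cases hτ : p τ
  · exact absurd h (not_lt.2 (signRank_lt_of_not hτ hσ).le)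
  · have hne : τ ≠ σ := by rintro rfl; exact lt_irrefl _ h
    refine h.trans_le ?_
    have hτ' : ¬ (p τ ∨ τ = σ) := by tauto
    rw [signRank, signRank, if_neg hτ, if_neg hτ']
    refine Finset.card_le_card fun a => ?_
    simp only [Finset.mem_filter]
    grind

theorem signRank_pos (p : S → Prop) (σ : S) : 0 < signRank p σ := by
  classical
  unfold signRank
  split_ifs with h
  · exact Finset.card_pos.2 ⟨σ, by simp [h]⟩
  · exact Finset.card_pos.2 ⟨σ, by simp⟩

theorem exists_signRank_eq_one [Nonempty S] (p : S → Prop) : ∃ σ, signRank p σ = 1 := by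
  classical
  by_cases hp : ∃ σ, p σ
  · obtain ⟨σ, hσ, hmin⟩ := (Finset.univ.filter p).exists_min_image id
      (by obtain ⟨σ, h⟩ := hp; exact ⟨σ, by simp [h]⟩)
    refine ⟨σ, ?_⟩
    simp only [Finset.mem_filter, Finset.mem_univ, true_and, id] at hσ hmin
    rw [signRank, if_pos hσ, Finset.card_eq_one]
    refine ⟨σ, Finset.ext fun a => ?_⟩
    simp only [Finset.mem_filter, Finset.mem_univ, true_and, Finset.mem_singleton]
    exact ⟨fun h => le_antisymm h.2 (hmin a h.1), by rintro rfl; exact ⟨hσ, le_rfl⟩⟩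
  · obtain ⟨σ, -, hmin⟩ := (Finset.univ : Finset S).exists_min_image id Finset.univ_nonempty
    refine ⟨σ, ?_⟩
    simp only [Finset.mem_univ, true_implies, id] at hmin
    rw [signRank, if_neg fun h => hp ⟨σ, h⟩, Finset.card_eq_one]
    refine ⟨σ, Finset.ext fun a => ?_⟩
    simp only [Finset.mem_filter, Finset.mem_univ, true_and, Finset.mem_singleton]
    exact ⟨fun h => h.elim (fun h => le_antisymm h (hmin a)) fun h => absurd ⟨a, h⟩ hp,
      fun h => Or.inl h.le⟩

end SignRank

/-! ### Normal forms, their order and their covering relations. -/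

theorem bar_bar {n : ℕ} (a : Ground n) : bar (bar a) = a := by simp [bar]

theorem bar_ne {n : ℕ} (a : Ground n) : bar a ≠ a := by simp [bar, Prod.ext_iff]

theorem eq_or_eq_bar {n : ℕ} {a b : Ground n} (h : a.1 = b.1) : a = b ∨ a = bar b := by
  obtain ⟨i, ε⟩ := a
  obtain ⟨j, δ⟩ := b
  obtain rfl : i = j := h
  cases ε <;> cases δ <;> simp [bar]

/-- The involution `bar`, extended to the signs by fixing them. -/
def barElem {n : ℕ} {S : Type*} : Ground n ⊕ S → Ground n ⊕ S := Sum.map bar id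

section BarElem

variable {n : ℕ} {S : Type*}

@[simp] theorem barElem_inl (a : Ground n) : barElem (.inl a : Ground n ⊕ S) = .inl (bar a) := rfl

@[simp] theorem barElem_inr (σ : S) : barElem (.inr σ : Ground n ⊕ S) = .inr σ := rfl

@[simp] theorem barElem_barElem (e : Ground n ⊕ S) : barElem (barElem e) = e := by
  cases e <;> simp [bar_bar]

end BarElem

/-- A labeled partition in normal form: every element is sent to the sign of its block, or, if the
block is unsigned, to the element of the block with the least absolute value. -/
@[ext]
structure NormalForm (n : ℕ) (S : Type*) where
  /-- the map sending an element to the label of its block -/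
  toFun : Ground n → Ground n ⊕ S
  map_bar : ∀ a, toFun (bar a) = barElem (toFun a)
  idem : ∀ a b, toFun a = .inl b → toFun b = .inl b
  fst_le : ∀ a b, toFun a = .inl b → b.1 ≤ a.1

namespace NormalForm

variable {n : ℕ} {S : Type*}

instance : CoeFun (NormalForm n S) (fun _ => Ground n → Ground n ⊕ S) := ⟨toFun⟩

instance [Finite S] : Finite (NormalForm n S) :=
  Finite.of_injective toFun fun _ _ h => NormalForm.ext h

/-- A normal form, extended to the signs by fixing them. -/
def extend (x : NormalForm n S) : Ground n ⊕ S → Ground n ⊕ S := Sum.elim x Sum.inr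

@[simp] theorem extend_inl (x : NormalForm n S) (a : Ground n) : x.extend (.inl a) = x a := rfl

@[simp] theorem extend_inr (x : NormalForm n S) (σ : S) : x.extend (.inr σ) = .inr σ := rfl

theorem extend_barElem (x : NormalForm n S) (e : Ground n ⊕ S) :
    x.extend (barElem e) = barElem (x.extend e) := by
  cases e <;> simp [x.map_bar]

theorem extend_self (x : NormalForm n S) (a : Ground n) : x.extend (x a) = x a := by
  cases h : x a with
  | inl b => exact x.idem a b h
  | inr σ => rfl

/-- `(i, false)` is the least element of an unsigned block. -/
def IsRoot (x : NormalForm n S) (i : Fin n) : Prop := x (i, false) = .inl (i, false)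

theorem isRoot_iff {x : NormalForm n S} {b : Ground n} : x.IsRoot b.1 ↔ x b = .inl b := by
  obtain ⟨i, _ | _⟩ := b
  · rfl
  · have h : x (i, true) = barElem (x (i, false)) := x.map_bar (i, false)
    rw [h, IsRoot]
    constructor
    · intro h; rw [h]; rfl
    · intro h; rw [← barElem_barElem (x (i, false)), h]; rfl

theorem isRoot_of_eq {x : NormalForm n S} {a b : Ground n} (h : x a = .inl b) : x.IsRoot b.1 :=
  isRoot_iff.2 (x.idem a b h)

/-- The only alternative is `b = bar a`; then idempotence fixes `bar a`, while compatibility with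
the bar sends it to `a`. -/
theorem eq_of_fst_le {x : NormalForm n S} {a b : Ground n} (h : x a = .inl b) (hab : a.1 ≤ b.1) :
    b = a := by
  rcases eq_or_eq_bar (le_antisymm (x.fst_le a b h) hab) with h1 | rfl
  · exact h1
  · have h2 := x.idem _ _ h
    rw [x.map_bar, h, barElem_inl, bar_bar] at h2
    exact absurd (Sum.inl.inj h2).symm (bar_ne a)

/-- The relation says that `y` is constant on the blocks of `x` and keeps their signs, written as
the composition law `y ∘ x = y` of substitutions. -/
instance : PartialOrder (NormalForm n S) where
  le x y := ∀ a, y.extend (x a) = y a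
  le_refl x := x.extend_self
  le_trans x y z hxy hyz a := by
    have key : ∀ e, z.extend (y.extend e) = z.extend e := by
      rintro (a | σ)
      · exact hyz a
      · rfl
    rw [← key, hxy, hyz]
  le_antisymm x y hxy hyx := by
    refine NormalForm.ext (funext fun a => ?_)
    have h1 := hxy a
    have h2 := hyx a
    cases hx : x a with
    | inr σ => rw [hx] at h1; exact h1
    | inl b =>
      cases hy : y a with
      | inr σ => rw [hy, hx] at h2; cases h2
      | inl c =>
        rw [hx, hy] at h1
        rw [hx, hy] at h2
        rw [eq_of_fst_le (x := x) h2 (y.fst_le _ _ h1)]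

theorem le_def {x y : NormalForm n S} : x ≤ y ↔ ∀ a, y.extend (x a) = y a := Iff.rfl

theorem IsRoot.of_le {x y : NormalForm n S} (hxy : x ≤ y) {i : Fin n} (h : y.IsRoot i) :
    x.IsRoot i := by
  have h1 := hxy (i, false)
  rw [show y (i, false) = _ from h] at h1
  cases hx : x (i, false) with
  | inr σ => rw [hx] at h1; cases h1
  | inl b =>
    rw [hx] at h1
    rw [IsRoot, hx, eq_of_fst_le hx (y.fst_le _ _ h1)]

/-- The order is controlled by the roots: going up strictly always loses one, and this replaces a
rank function below. -/
theorem eq_of_le_of_isRoot {x y : NormalForm n S} (hxy : x ≤ y)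
    (h : ∀ i, x.IsRoot i → y.IsRoot i) : x = y := by
  refine NormalForm.ext (funext fun a => ?_)
  have h1 := hxy a
  cases hx : x a with
  | inr σ => rw [hx] at h1; exact h1
  | inl b =>
    rw [hx] at h1
    rw [← h1]
    exact (isRoot_iff.1 (h _ (isRoot_of_eq hx))).symm

/-- The block of the root `j` of `x` can be merged with the block of `t`: the latter is a sign, or
a smaller root up to the involution. -/
def IsTarget (x : NormalForm n S) (j : Fin n) (t : Ground n ⊕ S) : Prop :=
  x.IsRoot j ∧ ∀ b, t = .inl b → b.1 < j ∧ x.IsRoot b.1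

/-- The substitution of `t` for `j`. -/
def subst (j : Fin n) (t : Ground n ⊕ S) : Ground n ⊕ S → Ground n ⊕ S :=
  Sum.elim (fun b => if b.1 = j then (if b.2 then barElem t else t) else .inl b) .inr

theorem subst_inl_self (j : Fin n) (t : Ground n ⊕ S) : subst j t (.inl (j, false)) = t := by
  simp [subst]

theorem subst_inl_of_ne {j : Fin n} (t : Ground n ⊕ S) {b : Ground n} (h : b.1 ≠ j) :
    subst j t (.inl b) = .inl b := by
  simp [subst, h]

theorem subst_barElem (j : Fin n) (t e : Ground n ⊕ S) :
    subst j t (barElem e) = barElem (subst j t e) := by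
  rcases e with ⟨k, _ | _⟩ | σ
  · by_cases h : k = j <;> simp [subst, bar, h]
  · by_cases h : k = j <;> simp [subst, bar, h]
  · simp [subst]

theorem subst_eq_inl {x : NormalForm n S} {j : Fin n} {t : Ground n ⊕ S} (h : x.IsTarget j t)
    {a b : Ground n} (hab : subst j t (x a) = .inl b) :
    b.1 ≠ j ∧ x.IsRoot b.1 ∧ b.1 ≤ a.1 := by
  have ht : ∀ c, t = .inl c ∨ barElem t = .inl c → c.1 < j ∧ x.IsRoot c.1 := by
    rintro c (hc | hc)
    · exact h.2 c hc
    · have := h.2 (bar c) (by rw [← barElem_barElem t, hc, barElem_inl])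
      exact this
  cases hx : x a with
  | inr σ => rw [hx] at hab; cases hab
  | inl c =>
    rw [hx] at hab
    by_cases hc : c.1 = j
    · have h3 : t = .inl b ∨ barElem t = .inl b := by
        simp only [subst, Sum.elim_inl, hc, if_true] at hab
        split_ifs at hab
        · exact .inr hab
        · exact .inl hab
      obtain ⟨h1, h2⟩ := ht b h3
      exact ⟨h1.ne, h2, h1.le.trans (hc ▸ x.fst_le _ _ hx)⟩
    · rw [subst_inl_of_ne t hc] at hab
      obtain rfl := Sum.inl.inj hab
      exact ⟨hc, isRoot_of_eq hx, x.fst_le _ _ hx⟩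

/-- The result of merging the block of the root `j` with the block of `t`. -/
def move (x : NormalForm n S) (j : Fin n) (t : Ground n ⊕ S) (h : x.IsTarget j t) :
    NormalForm n S where
  toFun a := subst j t (x a)
  map_bar a := by rw [x.map_bar, subst_barElem]
  idem a b hab := by
    obtain ⟨h1, h2, -⟩ := subst_eq_inl h hab
    rw [isRoot_iff.1 h2, subst_inl_of_ne t h1]
  fst_le a b hab := (subst_eq_inl h hab).2.2

section Move

variable {x : NormalForm n S} {j : Fin n} {t : Ground n ⊕ S} (h : x.IsTarget j t)

theorem move_apply (a : Ground n) : x.move j t h a = subst j t (x a) := rfl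

theorem move_apply_self : x.move j t h (j, false) = t := by
  rw [move_apply, show x (j, false) = _ from h.1, subst_inl_self]

theorem move_apply_of_ne {b : Ground n} (hb : x.IsRoot b.1) (hj : b.1 ≠ j) :
    x.move j t h b = .inl b := by
  rw [move_apply, isRoot_iff.1 hb, subst_inl_of_ne t hj]

theorem isRoot_move {i : Fin n} : (x.move j t h).IsRoot i ↔ x.IsRoot i ∧ i ≠ j := by
  constructor
  · intro hi
    obtain ⟨h1, h2, -⟩ := subst_eq_inl h (a := (i, false)) hi
    exact ⟨h2, h1⟩
  · rintro ⟨hi, hj⟩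
    exact move_apply_of_ne h (b := (i, false)) hi hj

theorem extend_subst {y : NormalForm n S} (hj : y (j, false) = y.extend t) (e : Ground n ⊕ S) :
    y.extend (subst j t e) = y.extend e := by
  rcases e with ⟨k, _ | _⟩ | σ
  · by_cases hk : k = j
    · subst hk; rw [subst_inl_self, extend_inl, hj]
    · rw [subst_inl_of_ne t hk]
  · by_cases hk : k = j
    · subst hk
      change y.extend (subst k t (barElem (.inl (k, false)))) = y.extend (barElem (.inl (k, false)))
      rw [subst_barElem, subst_inl_self, extend_barElem, extend_barElem, extend_inl, hj]
    · rw [subst_inl_of_ne t hk]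
  · rfl

theorem move_le_iff {y : NormalForm n S} (hxy : x ≤ y) :
    x.move j t h ≤ y ↔ y (j, false) = y.extend t := by
  constructor
  · intro hy
    rw [← hy, move_apply_self]
  · intro hy a
    rw [move_apply, extend_subst hy, hxy]

theorem le_move : x ≤ x.move j t h := by
  intro a
  cases hx : x a with
  | inr σ => rw [move_apply, hx]; rfl
  | inl b => rw [extend_inl, move_apply, move_apply, x.idem a b hx, hx]

theorem lt_move : x < x.move j t h := by
  refine lt_of_le_of_ne (le_move h) fun he => ?_
  have h1 := h.1
  rw [he, isRoot_move] at h1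
  exact h1.2 rfl

end Move

/-- Some root `j` of `x` is no longer a root of `y`; substituting its image under `y` for it is a
legitimate move, because roots of `y` are roots of `x`. -/
theorem exists_move_le {x y : NormalForm n S} (hxy : x < y) :
    ∃ j t, ∃ h : x.IsTarget j t, x.move j t h ≤ y := by
  obtain ⟨j, hj, hjy⟩ : ∃ j, x.IsRoot j ∧ ¬ y.IsRoot j := by
    by_contra! hc
    exact hxy.ne (eq_of_le_of_isRoot hxy.le hc)
  have ht : x.IsTarget j (y (j, false)) := by
    refine ⟨hj, fun b hb => ⟨lt_of_not_ge fun hle => hjy ?_, (isRoot_of_eq hb).of_le hxy.le⟩⟩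
    rw [IsRoot, hb, eq_of_fst_le hb hle]
  exact ⟨j, _, ht, (move_le_iff ht hxy.le).2 (y.extend_self _).symm⟩

/-- A move loses the single root `j`, and an element strictly between would already have lost it, so
it has no more roots than the result of the move. -/
theorem covBy_move {x : NormalForm n S} {j : Fin n} {t : Ground n ⊕ S} (h : x.IsTarget j t) :
    x ⋖ x.move j t h := by
  refine ⟨lt_move h, fun z hxz hz => hz.ne (eq_of_le_of_isRoot hz.le fun i hi => ?_)⟩
  obtain ⟨k, s, hk, hkz⟩ := exists_move_le hxz
  have hsub : ∀ i, z.IsRoot i → x.IsRoot i ∧ i ≠ k := fun i hi =>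
    (isRoot_move hk).1 (hi.of_le hkz)
  by_contra hi'
  have h3 : i ≠ j → False := fun hij => hi' ((isRoot_move h).2 ⟨(hsub i hi).1, hij⟩)
  obtain rfl : i = j := by_contra h3
  have h4 := isRoot_move h |>.2 ⟨hk.1, fun e => (hsub i hi).2 e.symm⟩
  exact (hsub k (h4.of_le hz.le)).2 rfl

theorem exists_eq_move {x z : NormalForm n S} (hxz : x ⋖ z) :
    ∃ j t, ∃ h : x.IsTarget j t, z = x.move j t h := by
  obtain ⟨j, t, h, hle⟩ := exists_move_le hxz.lt
  exact ⟨j, t, h, ((hxz.eq_or_eq (le_move h) hle).resolve_left (lt_move h).ne').symm⟩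

end NormalForm

/-! ### Moves inside an interval. -/

namespace NormalForm

variable {n : ℕ} {S : Type*}

/-- Some block of `x` has sign `σ`. -/
def HasSign (x : NormalForm n S) (σ : S) : Prop := ∃ a, x a = .inr σ

theorem hasSign_move_inl {x : NormalForm n S} {j : Fin n} {b : Ground n}
    (h : x.IsTarget j (.inl b)) : (x.move j (.inl b) h).HasSign = x.HasSign := by
  funext τ
  refine propext ⟨?_, ?_⟩
  · rintro ⟨a, ha⟩
    refine ⟨a, ?_⟩
    rw [move_apply] at ha
    cases hx : x a with
    | inr σ => rw [hx] at ha; exact ha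
    | inl c =>
      rw [hx] at ha
      simp only [subst, Sum.elim_inl] at ha
      split_ifs at ha
      cases ha
  · rintro ⟨a, ha⟩
    exact ⟨a, by rw [move_apply, ha]; rfl⟩

theorem hasSign_move_inr {x : NormalForm n S} {j : Fin n} {σ : S}
    (h : x.IsTarget j (.inr σ)) :
    (x.move j (.inr σ) h).HasSign = fun τ => x.HasSign τ ∨ τ = σ := by
  funext τ
  refine propext ⟨?_, ?_⟩
  · rintro ⟨a, ha⟩
    rw [move_apply] at ha
    cases hx : x a with
    | inr σ => rw [hx] at ha; exact .inl ⟨a, by rw [hx]; exact ha⟩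
    | inl c =>
      rw [hx] at ha
      simp only [subst, Sum.elim_inl, barElem_inr] at ha
      split_ifs at ha
      · exact .inr (Sum.inr.inj ha).symm
      · exact .inr (Sum.inr.inj ha).symm
  · rintro (⟨a, ha⟩ | rfl)
    · exact ⟨a, by rw [move_apply, ha]; rfl⟩
    · exact ⟨_, move_apply_self h⟩

/-- `e` and `e'` lie in the same block of `y`; all elements do if `y` is the top element. -/
def Compat (y : WithTop (NormalForm n S)) (e e' : Ground n ⊕ S) : Prop :=
  ∀ z : NormalForm n S, y = z → z.extend e = z.extend e'

namespace Compat

variable {y : WithTop (NormalForm n S)} {e e' e'' : Ground n ⊕ S}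

theorem symm (h : Compat y e e') : Compat y e' e := fun z hz => (h z hz).symm

theorem trans (h : Compat y e e') (h' : Compat y e' e'') : Compat y e e'' :=
  fun z hz => (h z hz).trans (h' z hz)

theorem barElem (h : Compat y e e') : Compat y (barElem e) (barElem e') := fun z hz => by
  rw [extend_barElem, extend_barElem, h z hz]

theorem top : Compat (⊤ : WithTop (NormalForm n S)) e e' := fun z hz => by cases hz

end Compat

/-- Merging the block of the root `j` with the block of `t` yields an element below `y`, if `x`
is below `y`. -/
def IsAdmissible (x : NormalForm n S) (y : WithTop (NormalForm n S)) (j : Fin n)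
    (t : Ground n ⊕ S) : Prop :=
  x.IsTarget j t ∧ Compat y (.inl (j, false)) t

theorem coe_move_le_iff {x : NormalForm n S} {y : WithTop (NormalForm n S)} (hxy : ↑x ≤ y)
    {j : Fin n} {t : Ground n ⊕ S} (h : x.IsTarget j t) :
    ↑(x.move j t h) ≤ y ↔ Compat y (.inl (j, false)) t := by
  cases y with
  | top => exact ⟨fun _ => Compat.top, fun _ => le_top⟩
  | coe y =>
    rw [WithTop.coe_le_coe, move_le_iff h (WithTop.coe_le_coe.1 hxy)]
    exact ⟨fun h z hz => WithTop.coe_injective hz ▸ h, fun h => h y rfl⟩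

theorem isTarget_move {x : NormalForm n S} {j k : Fin n} {t s : Ground n ⊕ S}
    (h : x.IsTarget j t) : (x.move j t h).IsTarget k s ↔
      x.IsTarget k s ∧ k ≠ j ∧ ∀ b, s = .inl b → b.1 ≠ j := by
  simp only [IsTarget, isRoot_move]
  grind

/-- The identifications prescribed by `y` do not depend on the move made, so moves are only lost,
and exactly those that involve `j`. -/
theorem isAdmissible_move {x : NormalForm n S} {y : WithTop (NormalForm n S)} {j k : Fin n}
    {t s : Ground n ⊕ S} (h : x.IsTarget j t) : (x.move j t h).IsAdmissible y k s ↔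
      x.IsAdmissible y k s ∧ k ≠ j ∧ ∀ b, s = .inl b → b.1 ≠ j := by
  simp only [IsAdmissible, isTarget_move]
  tauto

theorem isAdmissible_inl {x : NormalForm n S} {y : WithTop (NormalForm n S)} {i j : Fin n}
    (hi : x.IsRoot i) (hj : x.IsRoot j) (hij : i < j) (ε : Bool)
    (hc : Compat y (.inl (j, false)) (.inl (i, ε))) : x.IsAdmissible y j (.inl (i, ε)) :=
  ⟨⟨hj, fun b hb => by obtain rfl := Sum.inl.inj hb; exact ⟨hij, hi⟩⟩, hc⟩

theorem isAdmissible_inr {x : NormalForm n S} {y : WithTop (NormalForm n S)} {j : Fin n}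
    (hj : x.IsRoot j) {σ : S} (hc : Compat y (.inl (j, false)) (.inr σ)) :
    x.IsAdmissible y j (.inr σ) :=
  ⟨⟨hj, fun b hb => by cases hb⟩, hc⟩

theorem isMax_iff {x : NormalForm n S} : IsMax x ↔ ∀ j t, ¬ x.IsTarget j t := by
  constructor
  · intro hx j t h
    exact hx.not_lt (lt_move h)
  · intro hx
    by_contra hc
    obtain ⟨z, hz⟩ := not_isMax_iff.1 hc
    obtain ⟨j, t, h, -⟩ := exists_move_le hz
    exact hx j t h

/-! ### Comparison of the labels of moves; the combinatorial core. -/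

section Label

variable [Fintype S] [LinearOrder S]

/-- The label of the edge from `x` to `x.move j t`. -/
noncomputable def moveLabel (x : NormalForm n S) (j : Fin n) : Ground n ⊕ S → ℕ ×ₗ ℕ
  | .inl (_, false) => toLex (0, (j : ℕ) + 1)
  | .inl (i, true) => toLex (2, (i : ℕ) + 1)
  | .inr σ => toLex (1, signRank x.HasSign σ)

theorem moveLabel_move_le {x : NormalForm n S} {j k : Fin n} {t s : Ground n ⊕ S}
    (h : x.IsTarget j t) (hle : x.moveLabel k s ≤ x.moveLabel j t) :
    (x.move j t h).moveLabel k s ≤ x.moveLabel j t := by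
  rcases s with ⟨i, _ | _⟩ | σ
  · exact hle
  · exact hle
  rcases t with b | τ
  · simpa only [moveLabel, hasSign_move_inl] using hle
  · simp only [moveLabel, hasSign_move_inr, Prod.Lex.toLex_le_toLex] at hle ⊢
    exact .inr ⟨trivial, signRank_insert_le (by simpa using hle)⟩

theorem lt_moveLabel_move {x : NormalForm n S} {j k : Fin n} {t s : Ground n ⊕ S}
    (h : x.IsTarget j t) (hlt : x.moveLabel j t < x.moveLabel k s) :
    x.moveLabel j t < (x.move j t h).moveLabel k s := by
  rcases s with ⟨i, _ | _⟩ | σ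
  · exact hlt
  · exact hlt
  rcases t with b | τ
  · simpa only [moveLabel, hasSign_move_inl] using hlt
  · simp only [moveLabel, hasSign_move_inr, Prod.Lex.toLex_lt_toLex] at hlt ⊢
    exact .inr ⟨trivial, lt_signRank_insert (by simpa using hlt)⟩

variable {x : NormalForm n S} {y : WithTop (NormalForm n S)} {i j k : Fin n} {s t : Ground n ⊕ S}

/-- A tie for the least label is impossible. Two coherent moves with equal labels move the same root
to distinct smaller roots, which can then be merged coherently with a smaller label. Two moves of
type 1 or 2 with equal labels have the same target, so the two roots moved can be merged coherently,
with a label of type 0. -/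
theorem lt_moveLabel_of_ne (hj : x.IsAdmissible y j t)
    (hmin : ∀ k s, x.IsAdmissible y k s → x.moveLabel j t ≤ x.moveLabel k s)
    (hk : x.IsAdmissible y k s) (hne : ¬ (k = j ∧ s = t)) :
    x.moveLabel j t < x.moveLabel k s := by
  refine lt_of_le_of_ne (hmin k s hk) fun heq => ?_
  have coh : ∀ i l, x.IsRoot i → x.IsRoot l → i < l →
      Compat y (.inl (l, false)) (.inl (i, false)) →
      x.moveLabel j t ≤ toLex (0, (l : ℕ) + 1) := fun i l hi hl hil hc =>
    hmin l (.inl (i, false)) (isAdmissible_inl hi hl hil false hc)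
  have coh' : ∀ i l, x.IsRoot i → x.IsRoot l → i ≠ l →
      Compat y (.inl (i, false)) (.inl (l, false)) →
      x.moveLabel j t ≤ toLex (0, (max i l : ℕ) + 1) := fun i l hi hl hil hc => by
    rcases lt_or_gt_of_ne hil with h | h
    · rw [max_eq_right (by exact_mod_cast h.le)]
      exact coh i l hi hl h hc.symm
    · rw [max_eq_left (by exact_mod_cast h.le)]
      exact coh l i hl hi h hc
  rcases t with ⟨i, _ | _⟩ | σ <;> rcases s with ⟨i', _ | _⟩ | σ' <;>
    simp [moveLabel] at heq
  · obtain rfl : j = k := Fin.ext heq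
    have h1 := hj.1.2 _ rfl
    have h2 := hk.1.2 _ rfl
    have h3 := coh' i i' h1.2 h2.2 (fun e => hne ⟨rfl, by rw [e]⟩) (hj.2.symm.trans hk.2)
    have h4 : (i : ℕ) < j := h1.1
    have h5 : (i' : ℕ) < j := h2.1
    simp only [moveLabel, Prod.Lex.toLex_le_toLex] at h3
    omega
  · obtain rfl : i = i' := Fin.ext heq
    have h3 := coh' j k hj.1.1 hk.1.1 (fun e => hne ⟨e.symm, rfl⟩) (hj.2.trans hk.2.symm)
    simp [moveLabel, Prod.Lex.toLex_le_toLex] at h3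
  · obtain rfl := signRank_injective _ heq
    have h3 := coh' j k hj.1.1 hk.1.1 (fun e => hne ⟨e.symm, rfl⟩) (hj.2.trans hk.2.symm)
    simp [moveLabel, Prod.Lex.toLex_le_toLex] at h3

/-- Below the top every move is admissible. So a least label is not of type 2, as dropping the bar
gives type 0, and if it is of type 1 it is `(1, 1)`, as some sign has rank one. -/
theorem moveLabel_lt_of_min_top (hj : x.IsAdmissible ⊤ j t)
    (hmin : ∀ k s, x.IsAdmissible ⊤ k s → x.moveLabel j t ≤ x.moveLabel k s) :
    x.moveLabel j t < toLex (1, 2) := by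
  rcases t with ⟨i, _ | _⟩ | σ
  · simp [moveLabel, Prod.Lex.toLex_lt_toLex]
  · have h1 := hj.1.2 _ rfl
    have h3 := hmin j (.inl (i, false)) (isAdmissible_inl h1.2 hj.1.1 h1.1 false Compat.top)
    simp [moveLabel, Prod.Lex.toLex_le_toLex] at h3
  · have : Nonempty S := ⟨σ⟩
    obtain ⟨τ, hτ⟩ := exists_signRank_eq_one x.HasSign
    have h3 := hmin j (.inr τ) (isAdmissible_inr hj.1.1 Compat.top)
    simp only [moveLabel, hτ, Prod.Lex.toLex_le_toLex, Prod.Lex.toLex_lt_toLex] at h3 ⊢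
    simp only [lt_irrefl, true_and, false_or] at h3 ⊢
    omega

/-- After an admissible move whose label is not the least one, some edge does not increase the
label. -/
theorem exists_isAdmissible_move_le (hk : x.IsAdmissible y k s)
    (hmin : ∀ j t, x.IsAdmissible y j t → x.moveLabel k s ≤ x.moveLabel j t)
    (hj : x.IsAdmissible y j t) (hlt : x.moveLabel k s < x.moveLabel j t) :
    (∃ l r, (x.move j t hj.1).IsAdmissible y l r ∧
      (x.move j t hj.1).moveLabel l r ≤ x.moveLabel j t) ∨
    (y = ⊤ ∧ IsMax (x.move j t hj.1) ∧ toLex (1, 2) ≤ x.moveLabel j t) := by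
  have next : ∀ l r, x.IsAdmissible y l r → l ≠ j → (∀ b, r = .inl b → b.1 ≠ j) →
      x.moveLabel l r ≤ x.moveLabel j t →
      (∃ l r, (x.move j t hj.1).IsAdmissible y l r ∧
        (x.move j t hj.1).moveLabel l r ≤ x.moveLabel j t) := fun l r hl hlj hr hle =>
    ⟨l, r, (isAdmissible_move hj.1).2 ⟨hl, hlj, hr⟩, moveLabel_move_le hj.1 hle⟩
  have nextSign : ∀ i σ, x.IsRoot i → i ≠ j → Compat y (.inl (i, false)) (.inr σ) →
      toLex (1, signRank x.HasSign σ) ≤ x.moveLabel j t →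
      (∃ l r, (x.move j t hj.1).IsAdmissible y l r ∧
        (x.move j t hj.1).moveLabel l r ≤ x.moveLabel j t) := fun i σ hi hij hc hle =>
    next i (.inr σ) (isAdmissible_inr hi hc) hij (fun b hb => by cases hb) hle
  -- If both moves displace the same root `k`, then `y` identifies `s` with `t`, and a move
  -- realizing this identification is sought.
  by_cases hkj : k = j
  · subst hkj
    rcases t with ⟨i, _ | _⟩ | σ
    · rcases s with ⟨i', _ | _⟩ | σ' <;>
        simp [moveLabel, Prod.Lex.toLex_lt_toLex] at hlt
    · have hi := hj.1.2 _ rfl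
      -- Below the top any further move has a version of type 0 or 1; if there is none, the edge to
      -- the top has label `(1, 2)`, below type 2.
      have nextTop : y = ⊤ →
          (∃ l r, (x.move k (.inl (i, true)) hj.1).IsAdmissible y l r ∧
            (x.move k (.inl (i, true)) hj.1).moveLabel l r ≤ x.moveLabel k (.inl (i, true))) ∨
          (y = ⊤ ∧ IsMax (x.move k (.inl (i, true)) hj.1) ∧
            toLex (1, 2) ≤ x.moveLabel k (.inl (i, true))) := fun hy => by
        subst hy
        by_cases hmax : IsMax (x.move k (.inl (i, true)) hj.1)
        · exact .inr ⟨rfl, hmax, by simp [moveLabel, Prod.Lex.toLex_le_toLex]⟩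
        refine .inl ?_
        rw [isMax_iff] at hmax
        push Not at hmax
        obtain ⟨l, r, hlr⟩ := hmax
        rcases r with ⟨m, _ | _⟩ | σ
        · exact ⟨l, _, ⟨hlr, Compat.top⟩, by simp [moveLabel, Prod.Lex.toLex_le_toLex]⟩
        · have hm := hlr.2 _ rfl
          exact ⟨l, .inl (m, false), isAdmissible_inl hm.2 hlr.1 hm.1 false Compat.top,
            by simp [moveLabel, Prod.Lex.toLex_le_toLex]⟩
        · exact ⟨l, _, ⟨hlr, Compat.top⟩, by simp [moveLabel, Prod.Lex.toLex_le_toLex]⟩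
      rcases s with ⟨i', _ | _⟩ | σ'
      · have hi' := hk.1.2 _ rfl
        rcases lt_trichotomy i i' with h | rfl | h
        · exact .inl (next i' (.inl (i, true))
            (isAdmissible_inl hi.2 hi'.2 h true (hk.2.symm.trans hj.2)) hi'.1.ne
            (fun b hb => by obtain rfl := Sum.inl.inj hb; exact hi.1.ne) le_rfl)
        -- Here `y` identifies `i` with its own bar. Unless `y` is the top, that block is signed,
        -- and `i` can be moved to its sign with a label of type 1.
        · by_cases hy : y = ⊤
          · exact nextTop hy
          obtain ⟨y, rfl⟩ := WithTop.ne_top_iff_exists.1 hy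
          have hc : y (i, false) = barElem (y (i, false)) := by
            rw [← y.map_bar]
            exact (hk.2.symm.trans hj.2) y rfl
          cases hyi : y (i, false) with
          | inl b =>
            rw [hyi] at hc
            exact absurd (Sum.inl.inj hc).symm (bar_ne b)
          | inr σ =>
            refine .inl (nextSign i σ hi.2 hi.1.ne (fun z hz => ?_) ?_)
            · obtain rfl := WithTop.coe_injective hz
              exact hyi
            · simp [moveLabel, Prod.Lex.toLex_le_toLex]
        · have hc : Compat y (.inl (i, false)) (.inl (i', true)) :=
            (hj.2.symm.trans hk.2).barElem
          refine .inl (next i (.inl (i', true))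
            (isAdmissible_inl hi'.2 hi.2 h true hc) hi.1.ne
            (fun b hb => by obtain rfl := Sum.inl.inj hb; exact hi'.1.ne) ?_)
          simp only [moveLabel, Prod.Lex.toLex_le_toLex, lt_irrefl, true_and, false_or]
          exact Nat.succ_le_succ h.le
      · have hi' := hk.1.2 _ rfl
        have hne : i ≠ i' := by
          rintro rfl
          exact lt_irrefl _ hlt
        have hc : Compat y (.inl (i, false)) (.inl (i', false)) :=
          (hj.2.symm.trans hk.2).barElem
        rcases lt_or_gt_of_ne hne with h | h
        · exact .inl (next i' (.inl (i, false)) (isAdmissible_inl hi.2 hi'.2 h false hc.symm)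
            hi'.1.ne (fun b hb => by obtain rfl := Sum.inl.inj hb; exact hi.1.ne)
            (by simp [moveLabel, Prod.Lex.toLex_le_toLex]))
        · exact .inl (next i (.inl (i', false)) (isAdmissible_inl hi'.2 hi.2 h false hc)
            hi.1.ne (fun b hb => by obtain rfl := Sum.inl.inj hb; exact hi'.1.ne)
            (by simp [moveLabel, Prod.Lex.toLex_le_toLex]))
      · exact .inl (nextSign i σ' hi.2 hi.1.ne (hj.2.symm.trans hk.2).barElem
          (by simp [moveLabel, Prod.Lex.toLex_le_toLex]))
    · rcases s with ⟨i, _ | _⟩ | σ'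
      · have hi := hk.1.2 _ rfl
        exact .inl (nextSign i σ hi.2 hi.1.ne (hk.2.symm.trans hj.2) le_rfl)
      · simp [moveLabel, Prod.Lex.toLex_lt_toLex] at hlt
      -- Two different signs are identified only by the top. A root left after the move could have
      -- been merged coherently with `k`, against minimality, so the result is maximal. As `σ'` has
      -- rank at least 1, `σ` has rank at least 2, which is where the label `(1, 2)` of the top
      -- edges is needed.
      · have hne : σ' ≠ σ := by
          rintro rfl
          exact lt_irrefl _ hlt
        have hy : y = ⊤ := by
          by_contra hy
          obtain ⟨y, rfl⟩ := WithTop.ne_top_iff_exists.1 hy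
          exact hne (Sum.inr.inj ((hk.2.symm.trans hj.2) y rfl))
        subst hy
        refine .inr ⟨rfl, isMax_iff.2 fun l r hlr => ?_, ?_⟩
        · obtain ⟨hl, hlk⟩ := (isRoot_move hj.1).1 hlr.1
          rcases lt_or_gt_of_ne hlk with h | h
          · have h3 := hmin k (.inl (l, false)) (isAdmissible_inl hl hk.1.1 h false Compat.top)
            simp [moveLabel, Prod.Lex.toLex_le_toLex] at h3
          · have h3 := hmin l (.inl (k, false)) (isAdmissible_inl hk.1.1 hl h false Compat.top)
            simp [moveLabel, Prod.Lex.toLex_le_toLex] at h3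
        · have := signRank_pos x.HasSign σ'
          simp only [moveLabel, Prod.Lex.toLex_le_toLex, Prod.Lex.toLex_lt_toLex, lt_irrefl,
            true_and, false_or] at hlt ⊢
          omega
  · by_cases hs : ∀ b, s = .inl b → b.1 ≠ j
    · exact .inl (next k s hk hkj hs hlt.le)
    push Not at hs
    -- The least move sends `k` to the root `i` that the other move has displaced to `t`. For `ε =
    -- false` the replacement is to send `k` directly to `t`.
    obtain ⟨⟨i, ε⟩, rfl, rfl⟩ := hs
    have hik : i < k := (hk.1.2 _ rfl).1
    refine .inl ?_
    rcases ε with _ | _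
    · rcases t with ⟨m, _ | _⟩ | σ
      · have : (i : ℕ) < k := hik
        simp only [moveLabel, Prod.Lex.toLex_lt_toLex] at hlt
        omega
      · have hm := hj.1.2 _ rfl
        exact next k (.inl (m, true)) (isAdmissible_inl hm.2 hk.1.1 (hm.1.trans hik) true
          (hk.2.trans hj.2)) hkj (fun b hb => by obtain rfl := Sum.inl.inj hb; exact hm.1.ne)
          le_rfl
      · exact nextSign k σ hk.1.1 hkj (hk.2.trans hj.2) le_rfl
    -- The least label is `(2, i + 1)`, but every move of `i` has a smaller one, since its target
    -- lies below `i` if it is a root.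
    · rcases t with ⟨m, _ | _⟩ | σ
      · simp [moveLabel, Prod.Lex.toLex_lt_toLex] at hlt
      · have : (m : ℕ) < i := (hj.1.2 _ rfl).1
        simp only [moveLabel, Prod.Lex.toLex_lt_toLex] at hlt
        omega
      · simp [moveLabel, Prod.Lex.toLex_lt_toLex] at hlt

end Label

end NormalForm

/-! ### The correspondence between normal forms and labeled partitions. -/

theorem mem_barSet {n : ℕ} {B : Finset (Ground n)} {a : Ground n} :
    a ∈ barSet B ↔ bar a ∈ B := by
  simp only [barSet, Finset.mem_image]
  exact ⟨by rintro ⟨b, hb, rfl⟩; rwa [bar_bar], fun h => ⟨_, h, bar_bar a⟩⟩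

theorem barSet_barSet {n : ℕ} (B : Finset (Ground n)) : barSet (barSet B) = B := by
  ext a
  rw [mem_barSet, mem_barSet, bar_bar]

namespace NormalForm

variable {n : ℕ} {S : Type*}

open Classical in
/-- The set of elements that are sent to `e`. -/
noncomputable def fiber (x : NormalForm n S) (e : Ground n ⊕ S) : Finset (Ground n) :=
  Finset.univ.filter fun a => x a = e

@[simp] theorem mem_fiber {x : NormalForm n S} {e : Ground n ⊕ S} {a : Ground n} :
    a ∈ x.fiber e ↔ x a = e := by
  simp [fiber]

theorem barSet_fiber (x : NormalForm n S) (e : Ground n ⊕ S) :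
    barSet (x.fiber e) = x.fiber (barElem e) := by
  ext a
  rw [mem_barSet, mem_fiber, mem_fiber, x.map_bar]
  exact ⟨fun h => by rw [← h, barElem_barElem], fun h => by rw [h, barElem_barElem]⟩

open Classical in
/-- The labeled partition with the given normal form. -/
noncomputable def toLabeledPartition (x : NormalForm n S) : LabeledPartition n S where
  partition := Finpartition.ofExistsUnique (Finset.univ.image fun a => x.fiber (x a))
    (fun _ _ => Finset.subset_univ _)
    (fun a _ => ⟨x.fiber (x a), ⟨Finset.mem_image_of_mem _ (Finset.mem_univ a), mem_fiber.2 rfl⟩, by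
      rintro B ⟨hB, haB⟩
      obtain ⟨b, -, rfl⟩ := Finset.mem_image.1 hB
      rw [mem_fiber.1 haB]⟩)
    (fun h => by
      obtain ⟨a, -, ha⟩ := Finset.mem_image.1 h
      exact Finset.notMem_empty a (ha ▸ mem_fiber.2 rfl))
  -- Signs that do not occur all have the empty fiber; non-emptiness excludes it and makes the
  -- chosen sign unique.
  sign B := if h : ∃ σ, B = x.fiber (.inr σ) ∧ B.Nonempty then some h.choose else none
  mem_of_sign B σ hB := by
    split_ifs at hB with h
    obtain ⟨h1, a, ha⟩ := h.choose_spec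
    rw [h1, mem_fiber] at ha
    refine Finset.mem_image.2 ⟨a, Finset.mem_univ a, ?_⟩
    rw [ha, ← h1]
  sign_injective B C σ hB hC := by
    split_ifs at hB with h
    split_ifs at hC with h'
    rw [h.choose_spec.1, h'.choose_spec.1, Option.some.inj hB, Option.some.inj hC]
  bar_mem B hB := by
    obtain ⟨a, -, rfl⟩ := Finset.mem_image.1 hB
    refine Finset.mem_image.2 ⟨bar a, Finset.mem_univ _, ?_⟩
    rw [barSet_fiber, x.map_bar]
  bar_eq_iff B hB := by
    obtain ⟨a, -, rfl⟩ := Finset.mem_image.1 hB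
    constructor
    · intro h
      have h1 : a ∈ barSet (x.fiber (x a)) := by rw [h, mem_fiber]
      rw [barSet_fiber, mem_fiber] at h1
      have h2 : ∃ σ, x.fiber (x a) = x.fiber (.inr σ) ∧ (x.fiber (x a)).Nonempty := by
        cases hx : x a with
        | inl b => rw [hx] at h1; exact absurd (Sum.inl.inj h1).symm (bar_ne b)
        | inr σ => exact ⟨σ, rfl, a, mem_fiber.2 hx⟩
      exact ⟨_, dif_pos h2⟩
    · rintro ⟨σ, h⟩
      split_ifs at h with h'
      rw [h'.choose_spec.1, barSet_fiber, barElem_inr]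

theorem mem_parts {x : NormalForm n S} {B : Finset (Ground n)} :
    B ∈ x.toLabeledPartition.partition.parts ↔ ∃ a, x.fiber (x a) = B := by
  classical
  simp [toLabeledPartition, Finpartition.ofExistsUnique]

theorem sign_eq_some {x : NormalForm n S} {B : Finset (Ground n)} {σ : S} :
    x.toLabeledPartition.sign B = some σ ↔ B = x.fiber (.inr σ) ∧ B.Nonempty := by
  simp only [toLabeledPartition]
  constructor
  · intro h
    split_ifs at h with h'
    obtain rfl := Option.some.inj h
    exact h'.choose_spec
  · intro h
    have h' : ∃ σ, B = x.fiber (.inr σ) ∧ B.Nonempty := ⟨σ, h⟩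
    rw [dif_pos h', Option.some_inj]
    obtain ⟨a, ha⟩ := h.2
    have h1 := ha
    have h2 := ha
    rw [h.1, mem_fiber] at h1
    rw [h'.choose_spec.1, mem_fiber, h1] at h2
    exact (Sum.inr.inj h2).symm

theorem hasSign_toLabeledPartition (x : NormalForm n S) :
    x.toLabeledPartition.HasSign = x.HasSign := by
  funext σ
  refine propext ⟨?_, ?_⟩
  · rintro ⟨B, hB⟩
    obtain ⟨rfl, a, ha⟩ := sign_eq_some.1 hB
    exact ⟨a, mem_fiber.1 ha⟩
  · rintro ⟨a, ha⟩
    exact ⟨_, sign_eq_some.2 ⟨rfl, a, mem_fiber.2 ha⟩⟩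

theorem signedBlock_toLabeledPartition (x : NormalForm n S) (σ : S) :
    x.toLabeledPartition.signedBlock σ = x.fiber (.inr σ) := by
  by_cases h : x.HasSign σ
  · obtain ⟨a, ha⟩ := h
    exact LabeledPartition.signedBlock_eq _ (sign_eq_some.2 ⟨rfl, a, mem_fiber.2 ha⟩)
  · rw [LabeledPartition.signedBlock, dif_neg (by rwa [hasSign_toLabeledPartition])]
    exact (Finset.eq_empty_of_forall_notMem fun a ha => h ⟨a, mem_fiber.1 ha⟩).symm

theorem isUnsignedBlock_iff {x : NormalForm n S} {R : Finset (Ground n)} :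
    x.toLabeledPartition.IsUnsignedBlock R ↔ ∃ b, x b = .inl b ∧ x.fiber (.inl b) = R := by
  constructor
  · rintro ⟨hR, hs⟩
    obtain ⟨a, rfl⟩ := mem_parts.1 hR
    cases hx : x a with
    | inl b => exact ⟨b, x.idem a b hx, rfl⟩
    | inr σ =>
      rw [sign_eq_some.2 ⟨by rw [hx], a, mem_fiber.2 rfl⟩] at hs
      cases hs
  · rintro ⟨b, hb, rfl⟩
    refine ⟨mem_parts.2 ⟨b, by rw [hb]⟩, Option.eq_none_iff_forall_ne_some.2 fun σ h => ?_⟩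
    have h1 := (sign_eq_some.1 h).1
    have h2 : b ∈ x.fiber (.inl b) := mem_fiber.2 hb
    rw [h1, mem_fiber, hb] at h2
    cases h2

theorem toLabeledPartition_le_iff {x y : NormalForm n S} :
    x.toLabeledPartition ≤ y.toLabeledPartition ↔ x ≤ y := by
  constructor
  · intro h a
    cases hx : x a with
    | inl b =>
      obtain ⟨T, hT, hsub⟩ := LabeledPartition.Refines.partition_le h (mem_parts.2 ⟨a, rfl⟩)
      obtain ⟨c, rfl⟩ := mem_parts.1 hT
      have h1 := mem_fiber.1 (hsub (mem_fiber.2 (rfl : x a = x a)))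
      have h2 := mem_fiber.1 (hsub (mem_fiber.2 ((x.idem a b hx).trans hx.symm)))
      rw [extend_inl, h1, h2]
    | inr σ =>
      have h1 := (h.1 σ (by rw [hasSign_toLabeledPartition]; exact ⟨a, hx⟩)).2
      rw [signedBlock_toLabeledPartition, signedBlock_toLabeledPartition] at h1
      exact (mem_fiber.1 (h1 (mem_fiber.2 hx))).symm
  · intro h
    have hs : ∀ a σ, x a = .inr σ → y a = .inr σ := fun a σ ha => by
      rw [← h a, ha, extend_inr]
    refine ⟨fun σ hσ => ?_, fun R hR => ?_⟩
    · rw [hasSign_toLabeledPartition] at hσ ⊢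
      rw [signedBlock_toLabeledPartition, signedBlock_toLabeledPartition]
      exact ⟨hσ.imp fun a => hs a σ, fun a ha => mem_fiber.2 (hs a σ (mem_fiber.1 ha))⟩
    · obtain ⟨a, rfl⟩ := mem_parts.1 hR.1
      have h1 : x.fiber (x a) ⊆ y.fiber (y a) := fun b hb => by
        rw [mem_fiber] at hb ⊢
        rw [← h b, ← h a, hb]
      exact ⟨_, mem_parts.2 ⟨a, rfl⟩, h1, Finset.image_subset_image h1⟩

end NormalForm

namespace LabeledPartition

variable {n : ℕ} {S : Type*}

theorem part_bar (p : LabeledPartition n S) (a : Ground n) :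
    p.partition.part (bar a) = barSet (p.partition.part a) :=
  p.partition.part_eq_of_mem (p.bar_mem _ (p.partition.part_mem.2 (Finset.mem_univ a)))
    (mem_barSet.2 (by rw [bar_bar]; exact p.partition.mem_part (Finset.mem_univ a)))

/-- `e` is the sign of the block of `a` or, if the block is unsigned, its element of least absolute
value. -/
def IsNormalElem (p : LabeledPartition n S) (a : Ground n) : Ground n ⊕ S → Prop
  | .inr σ => p.sign (p.partition.part a) = some σ
  | .inl b => p.sign (p.partition.part a) = none ∧ b ∈ p.partition.part a ∧
      ∀ c ∈ p.partition.part a, b.1 ≤ c.1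

/-- A block containing `b` and `bar b` equals its own bar, hence is signed. This makes the element
of least absolute value in an unsigned block unique. -/
theorem bar_notMem_part (p : LabeledPartition n S) {a b : Ground n}
    (hs : p.sign (p.partition.part a) = none) (hb : b ∈ p.partition.part a) :
    bar b ∉ p.partition.part a := by
  intro h
  have ha := p.partition.part_mem.2 (Finset.mem_univ a)
  have h1 : barSet (p.partition.part a) = p.partition.part a := by
    rw [← p.partition.part_eq_of_mem ha hb, ← part_bar, p.partition.part_eq_of_mem ha hb,
      p.partition.part_eq_of_mem ha h]
  obtain ⟨σ, hσ⟩ := (p.bar_eq_iff _ ha).1 h1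
  rw [hs] at hσ
  cases hσ

theorem exists_isNormalElem (p : LabeledPartition n S) (a : Ground n) :
    ∃ e, p.IsNormalElem a e := by
  cases hs : p.sign (p.partition.part a) with
  | some σ => exact ⟨.inr σ, hs⟩
  | none =>
    obtain ⟨b, hb, hmin⟩ := Finset.exists_min_image (p.partition.part a) Prod.fst
      ⟨a, p.partition.mem_part (Finset.mem_univ a)⟩
    exact ⟨.inl b, hs, hb, hmin⟩

theorem IsNormalElem.unique {p : LabeledPartition n S} {a : Ground n} {e e' : Ground n ⊕ S}
    (h : p.IsNormalElem a e) (h' : p.IsNormalElem a e') : e = e' := by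
  rcases e with b | σ <;> rcases e' with b' | σ'
  · rcases eq_or_eq_bar (le_antisymm (h.2.2 b' h'.2.1) (h'.2.2 b h.2.1)) with rfl | rfl
    · rfl
    · exact absurd h.2.1 (p.bar_notMem_part h.1 h'.2.1)
  · exact absurd (h.1.symm.trans h') (by simp)
  · exact absurd (h'.1.symm.trans h) (by simp)
  · rw [Option.some.inj (Eq.trans (Eq.symm h) h')]

theorem IsNormalElem.congr {p : LabeledPartition n S} {a b : Ground n} {e : Ground n ⊕ S}
    (h : p.IsNormalElem a e) (hab : p.partition.part b = p.partition.part a) :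
    p.IsNormalElem b e := by
  rcases e with c | σ
  · simpa only [IsNormalElem, hab] using h
  · simpa only [IsNormalElem, hab] using h

theorem IsNormalElem.bar {p : LabeledPartition n S} {a : Ground n} {e : Ground n ⊕ S}
    (h : p.IsNormalElem a e) : p.IsNormalElem (bar a) (barElem e) := by
  have ha := p.partition.part_mem.2 (Finset.mem_univ a)
  rcases e with b | σ
  · refine ⟨?_, ?_, fun c hc => ?_⟩
    · rw [part_bar]
      refine Option.eq_none_iff_forall_ne_some.2 fun σ hσ => ?_
      have h1 := (p.bar_eq_iff _ (p.mem_of_sign _ _ hσ)).2 ⟨σ, hσ⟩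
      rw [barSet_barSet] at h1
      rw [← h1, h.1] at hσ
      cases hσ
    · rw [part_bar, mem_barSet, bar_bar]
      exact h.2.1
    · rw [part_bar, mem_barSet] at hc
      exact h.2.2 (LabeledPartitions.bar c) hc
  · have h1 := (p.bar_eq_iff _ ha).2 ⟨σ, h⟩
    change p.sign _ = some σ
    rw [part_bar, h1]
    exact h

theorem part_eq_part_iff {p : LabeledPartition n S} {a b : Ground n} {e e' : Ground n ⊕ S}
    (ha : p.IsNormalElem a e) (hb : p.IsNormalElem b e') :
    p.partition.part b = p.partition.part a ↔ e' = e := by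
  constructor
  · intro h
    exact (hb.congr h.symm).unique ha
  · rintro rfl
    rcases e' with c | σ
    · exact p.partition.eq_of_mem_parts (p.partition.part_mem.2 (Finset.mem_univ b))
        (p.partition.part_mem.2 (Finset.mem_univ a)) hb.2.1 ha.2.1
    · exact p.sign_injective _ _ σ hb ha

theorem exists_toLabeledPartition_eq (p : LabeledPartition n S) :
    ∃ x : NormalForm n S, x.toLabeledPartition = p := by
  choose g hg using p.exists_isNormalElem
  have hfst : ∀ a b, g a = .inl b → p.IsNormalElem a (.inl b) := fun a b h => h ▸ hg a
  let x : NormalForm n S :=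
    { toFun := g
      map_bar := fun a => (hg (bar a)).unique (hg a).bar
      idem := fun a b h => (hg b).unique ((hfst a b h).congr (p.partition.part_eq_of_mem
        (p.partition.part_mem.2 (Finset.mem_univ a)) (hfst a b h).2.1))
      fst_le := fun a b h => (hfst a b h).2.2 a (p.partition.mem_part (Finset.mem_univ a)) }
  have hfib : ∀ a, x.fiber (x a) = p.partition.part a := fun a => by
    ext b
    rw [NormalForm.mem_fiber,
      p.partition.mem_part_iff_part_eq_part (Finset.mem_univ b) (Finset.mem_univ a)]
    exact (part_eq_part_iff (hg a) (hg b)).symm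
  refine ⟨x, LabeledPartition.ext (Finpartition.ext (Finset.ext fun B => ?_))
    (funext fun B => Option.ext fun σ => ?_)⟩
  · rw [NormalForm.mem_parts]
    constructor
    · rintro ⟨a, rfl⟩
      rw [hfib]
      exact p.partition.part_mem.2 (Finset.mem_univ a)
    · intro hB
      obtain ⟨a, ha⟩ := p.partition.nonempty_of_mem_parts hB
      exact ⟨a, by rw [hfib, p.partition.part_eq_of_mem hB ha]⟩
  · rw [NormalForm.sign_eq_some]
    constructor
    · rintro ⟨hB, a, ha⟩
      have h1 : x a = .inr σ := by rwa [hB, NormalForm.mem_fiber] at ha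
      rw [hB, ← h1, hfib]
      have := hg a
      rw [show g a = .inr σ from h1] at this
      exact this
    · intro hB
      obtain ⟨a, ha⟩ := p.partition.nonempty_of_mem_parts (p.mem_of_sign _ _ hB)
      have h1 := p.partition.part_eq_of_mem (p.mem_of_sign _ _ hB) ha
      have h2 : x a = .inr σ := (hg a).unique (show p.sign _ = _ by rwa [h1])
      exact ⟨by rw [← h2, hfib, h1], a, ha⟩

end LabeledPartition

namespace NormalForm

/-- Normal forms classify labeled partitions. -/
noncomputable def orderIso (n : ℕ) (S : Type*) : NormalForm n S ≃o LabeledPartition n S :=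
  RelIso.ofSurjective
    (OrderEmbedding.ofMapLEIff toLabeledPartition fun _ _ => toLabeledPartition_le_iff)
    LabeledPartition.exists_toLabeledPartition_eq

theorem orderIso_apply {n : ℕ} {S : Type*} (x : NormalForm n S) :
    orderIso n S x = x.toLabeledPartition := rfl

end NormalForm

/-! ### Agreement of the two labelings on moves. -/

namespace NormalForm

variable {n : ℕ} {S : Type*}

theorem rep_fiber {x : NormalForm n S} {b : Ground n} (hb : x b = .inl b) :
    rep (x.fiber (.inl b)) = b.1 + 1 := by
  refine IsLeast.csInf_eq ⟨⟨b, mem_fiber.2 hb, rfl⟩, ?_⟩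
  rintro k ⟨a, ha, rfl⟩
  exact Nat.succ_le_succ (x.fst_le a b (mem_fiber.1 ha))

theorem isUnsignedBlock_and_isNormalized_iff {x : NormalForm n S} {R : Finset (Ground n)} :
    x.toLabeledPartition.IsUnsignedBlock R ∧ IsNormalized R ↔
      ∃ i, x.IsRoot i ∧ x.fiber (.inl (i, false)) = R := by
  rw [isUnsignedBlock_iff]
  constructor
  · rintro ⟨⟨b, hb, rfl⟩, i, hi, hmem⟩
    rw [rep_fiber hb] at hi
    obtain rfl := eq_of_fst_le (mem_fiber.1 hmem) (Fin.le_def.2 (Nat.succ.inj hi).le)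
    exact ⟨i, hb, rfl⟩
  · rintro ⟨i, hi, rfl⟩
    exact ⟨⟨_, hi, rfl⟩, i, (rep_fiber hi).symm, mem_fiber.2 hi⟩

theorem isNormalizedPair_iff {x : NormalForm n S} {R R' : Finset (Ground n)} :
    x.toLabeledPartition.IsNormalizedPair R R' ↔ ∃ i k, i ≠ k ∧ x.IsRoot i ∧ x.IsRoot k ∧
      x.fiber (.inl (i, false)) = R ∧ x.fiber (.inl (k, false)) = R' := by
  constructor
  · rintro ⟨hne, h1, h2, h3, h4⟩
    obtain ⟨i, hi, rfl⟩ := isUnsignedBlock_and_isNormalized_iff.1 ⟨h1, h2⟩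
    obtain ⟨k, hk, rfl⟩ := isUnsignedBlock_and_isNormalized_iff.1 ⟨h3, h4⟩
    exact ⟨i, k, fun e => hne (by rw [e]), hi, hk, rfl, rfl⟩
  · rintro ⟨i, k, hne, hi, hk, rfl, rfl⟩
    have h1 := isUnsignedBlock_and_isNormalized_iff.2 ⟨i, hi, rfl⟩
    have h2 := isUnsignedBlock_and_isNormalized_iff.2 ⟨k, hk, rfl⟩
    refine ⟨fun he => ?_, h1.1, h1.2, h2.1, h2.2⟩
    have h3 : ((i, false) : Ground n) ∈ x.fiber (.inl (k, false)) := he ▸ mem_fiber.2 hi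
    rw [mem_fiber, show x (i, false) = _ from hi] at h3
    exact hne (congrArg Prod.fst (Sum.inl.inj h3))

variable {x : NormalForm n S} {j : Fin n} {t : Ground n ⊕ S}

/-- Unions of two unsigned blocks become blocks only as prescribed by the move. -/
theorem eq_of_union_mem_parts (h : x.IsTarget j t) {i k : Fin n} {ε : Bool} (hne : i ≠ k) (hi : x.IsRoot i)
    (hk : x.IsRoot k)
    (hu : x.fiber (.inl (i, false)) ∪ x.fiber (.inl (k, ε)) ∈
      (x.move j t h).toLabeledPartition.partition.parts) :
    (i = j ∧ t = .inl (k, ε)) ∨ (k = j ∧ t = .inl (i, ε)) := by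
  obtain ⟨a, ha⟩ := mem_parts.1 hu
  have hk' : x (k, ε) = .inl (k, ε) := isRoot_iff.1 hk
  have h1 : ((i, false) : Ground n) ∈ (x.move j t h).fiber (x.move j t h a) := by
    rw [ha]; exact Finset.mem_union_left _ (mem_fiber.2 hi)
  have h2 : ((k, ε) : Ground n) ∈ (x.move j t h).fiber (x.move j t h a) := by
    rw [ha]; exact Finset.mem_union_right _ (mem_fiber.2 hk')
  rw [mem_fiber] at h1 h2
  have h3 := h1.trans h2.symm
  rw [move_apply, move_apply, hk', show x (i, false) = _ from hi] at h3
  by_cases hij : i = j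
  · subst hij
    rw [subst_inl_self, subst_inl_of_ne t (b := (k, ε)) hne.symm] at h3
    exact .inl ⟨rfl, h3⟩
  · by_cases hkj : k = j
    · subst hkj
      rw [subst_inl_of_ne t (b := (i, false)) hij] at h3
      refine .inr ⟨rfl, ?_⟩
      cases ε with
      | false => rw [subst_inl_self] at h3; exact h3.symm
      | true =>
        rw [show (.inl (k, true) : Ground n ⊕ S) = barElem (.inl (k, false)) from rfl,
          subst_barElem, subst_inl_self] at h3
        -- The equation obtained is `barElem t = (i, false)`, so the bar passes to the other side.
        rw [← barElem_barElem t, ← h3]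
        rfl
    · rw [subst_inl_of_ne t (b := (i, false)) hij, subst_inl_of_ne t (b := (k, ε)) hkj] at h3
      exact absurd (congrArg Prod.fst (Sum.inl.inj h3)) hne

/-- The move sends `(j, false)` to `(i, ε)`, hence `(j, ε)` to `(i, false)` by compatibility with
the bar. -/
theorem union_mem_parts {i : Fin n} {ε : Bool} (h : x.IsTarget j (.inl (i, ε))) :
    x.fiber (.inl (i, false)) ∪ x.fiber (.inl (j, ε)) ∈
      (x.move j (.inl (i, ε)) h).toLabeledPartition.partition.parts := by
  obtain ⟨hij, hi⟩ := h.2 _ rfl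
  have hne : i ≠ j := hij.ne
  refine mem_parts.2 ⟨(i, false), ?_⟩
  rw [move_apply_of_ne h (b := (i, false)) hi hne]
  ext b
  rw [Finset.mem_union, mem_fiber, mem_fiber, mem_fiber, move_apply]
  cases hx : x b with
  | inr σ => simp [subst]
  | inl c =>
    obtain ⟨c, δ⟩ := c
    by_cases hc : c = j
    · subst hc
      cases δ <;> cases ε <;> simp [subst, bar, hne.symm]
    · rw [subst_inl_of_ne _ (b := (c, δ)) hc]
      simp [hc]

theorem isOfSign_move_iff {σ τ : S} (h : x.IsTarget j (.inr σ)) :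
    LabeledPartition.IsOfSign x.toLabeledPartition (x.move j (.inr σ) h).toLabeledPartition τ ↔
      τ = σ := by
  rw [LabeledPartition.IsOfSign, signedBlock_toLabeledPartition, signedBlock_toLabeledPartition]
  have hsub : ∀ τ, x.fiber (.inr τ) ⊆ (x.move j (.inr σ) h).fiber (.inr τ) := fun τ a ha => by
    rw [mem_fiber] at ha ⊢
    rw [move_apply, ha]
    rfl
  rw [Finset.ssubset_iff_of_subset (hsub τ)]
  constructor
  · rintro ⟨a, ha, ha'⟩
    rw [mem_fiber] at ha ha'
    rw [move_apply] at ha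
    cases hx : x a with
    | inr ρ => rw [hx] at ha ha'; exact absurd ha ha'
    | inl c =>
      rw [hx] at ha
      simp only [subst, Sum.elim_inl, barElem_inr, ite_self] at ha
      split_ifs at ha
      exact (Sum.inr.inj ha).symm
  · rintro rfl
    refine ⟨(j, false), mem_fiber.2 (move_apply_self h), fun hj => ?_⟩
    rw [mem_fiber, show x (j, false) = _ from h.1] at hj
    cases hj

/-- Valid for every witnessing pair, so that the pair chosen in `label` is irrelevant. -/
theorem isCoherentPair_move {p : Finset (Ground n) × Finset (Ground n)} (h : x.IsTarget j t)
    (hp : LabeledPartition.IsCoherentPair x.toLabeledPartition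
      (x.move j t h).toLabeledPartition p) :
    ∃ i, t = .inl (i, false) ∧ max (rep p.1) (rep p.2) = j + 1 := by
  obtain ⟨R, R'⟩ := p
  obtain ⟨i, k, hne, hi, hk, rfl, rfl⟩ := isNormalizedPair_iff.1 hp.1
  simp only [rep_fiber hi, rep_fiber hk]
  rcases eq_of_union_mem_parts h hne hi hk hp.2 with ⟨rfl, rfl⟩ | ⟨rfl, rfl⟩
  · have h1 : (k : ℕ) < i := (h.2 _ rfl).1
    exact ⟨k, rfl, by omega⟩
  · have h1 : (i : ℕ) < k := (h.2 _ rfl).1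
    exact ⟨i, rfl, by omega⟩

theorem isNonCoherentPair_move {p : Finset (Ground n) × Finset (Ground n)} (h : x.IsTarget j t)
    (hp : LabeledPartition.IsNonCoherentPair x.toLabeledPartition
      (x.move j t h).toLabeledPartition p) :
    ∃ i, t = .inl (i, true) ∧ min (rep p.1) (rep p.2) = i + 1 := by
  obtain ⟨R, R'⟩ := p
  obtain ⟨i, k, hne, hi, hk, rfl, rfl⟩ := isNormalizedPair_iff.1 hp.1
  have hu := hp.2
  simp only [barSet_fiber] at hu
  simp only [rep_fiber hi, rep_fiber hk]
  rcases eq_of_union_mem_parts h hne hi hk hu with ⟨rfl, rfl⟩ | ⟨rfl, rfl⟩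
  · have h1 : (k : ℕ) < i := (h.2 _ rfl).1
    exact ⟨k, rfl, by omega⟩
  · have h1 : (i : ℕ) < k := (h.2 _ rfl).1
    exact ⟨i, rfl, by omega⟩

theorem label_move [Fintype S] [LinearOrder S] (h : x.IsTarget j t) :
    x.toLabeledPartition.label (x.move j t h).toLabeledPartition = x.moveLabel j t := by
  have hpair : ∀ i ε, t = .inl (i, ε) → x.toLabeledPartition.IsNormalizedPair
      (x.fiber (.inl (i, false))) (x.fiber (.inl (j, false))) := by
    rintro i ε rfl
    obtain ⟨hij, hi⟩ := h.2 _ rfl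
    exact isNormalizedPair_iff.2 ⟨i, j, hij.ne, hi, h.1, rfl, rfl⟩
  unfold LabeledPartition.label
  rcases t with ⟨i, _ | _⟩ | σ
  · have hc : ∃ p, LabeledPartition.IsCoherentPair x.toLabeledPartition
        (x.move j _ h).toLabeledPartition p := ⟨(_, _), hpair i _ rfl, union_mem_parts h⟩
    obtain ⟨_, -, h1⟩ := isCoherentPair_move h hc.choose_spec
    rw [dif_pos hc, h1]
    rfl
  · have hc : ¬ ∃ p, LabeledPartition.IsCoherentPair x.toLabeledPartition
        (x.move j _ h).toLabeledPartition p := by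
      rintro ⟨p, hp⟩
      obtain ⟨_, h1, -⟩ := isCoherentPair_move h hp
      simp at h1
    have hc' : ∃ p, LabeledPartition.IsNonCoherentPair x.toLabeledPartition
        (x.move j _ h).toLabeledPartition p :=
      ⟨(_, _), hpair i _ rfl, (congrArg (_ ∪ ·) (barSet_fiber x _)).symm ▸ union_mem_parts h⟩
    obtain ⟨_, h1, h2⟩ := isNonCoherentPair_move h hc'.choose_spec
    obtain ⟨rfl, -⟩ := Prod.ext_iff.1 (Sum.inl.inj h1)
    rw [dif_neg hc, dif_pos hc', h2]
    rfl
  · have hc : ¬ ∃ p, LabeledPartition.IsCoherentPair x.toLabeledPartition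
        (x.move j _ h).toLabeledPartition p := by
      rintro ⟨p, hp⟩
      obtain ⟨_, h1, -⟩ := isCoherentPair_move h hp
      cases h1
    have hc' : ¬ ∃ p, LabeledPartition.IsNonCoherentPair x.toLabeledPartition
        (x.move j _ h).toLabeledPartition p := by
      rintro ⟨p, hp⟩
      obtain ⟨_, h1, -⟩ := isNonCoherentPair_move h hp
      cases h1
    have hs : ∃ τ, LabeledPartition.IsOfSign x.toLabeledPartition
        (x.move j _ h).toLabeledPartition τ := ⟨σ, (isOfSign_move_iff h).2 rfl⟩
    rw [dif_neg hc, dif_neg hc', dif_pos hs, (isOfSign_move_iff h).1 hs.choose_spec,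
      moveLabel, ← hasSign_toLabeledPartition]
    rfl

end NormalForm

/-! ### Transport to the poset and conclusion. -/

section Labeling

variable {n : ℕ} {S : Type*}

open NormalForm

instance [Finite S] : Finite (LabeledPartition n S) := Finite.of_equiv _ (orderIso n S).toEquiv

theorem exists_move_of_coe_covBy {x : NormalForm n S} {z : PiPoset n S}
    (hz : (x.toLabeledPartition : PiPoset n S) ⋖ z) (hne : z ≠ ⊤) :
    ∃ j t, ∃ h : x.IsTarget j t, z = (x.move j t h).toLabeledPartition := by
  obtain ⟨p, rfl⟩ := WithTop.ne_top_iff_exists.1 hne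
  obtain ⟨z, rfl⟩ := LabeledPartition.exists_toLabeledPartition_eq p
  have h1 : x ⋖ z := by
    rw [← apply_covBy_apply_iff (orderIso n S)]
    exact WithTop.coe_covBy_coe.1 hz
  obtain ⟨j, t, h, rfl⟩ := exists_eq_move h1
  exact ⟨j, t, h, rfl⟩

theorem coe_covBy_move {x : NormalForm n S} {j : Fin n} {t : Ground n ⊕ S}
    (h : x.IsTarget j t) :
    (x.toLabeledPartition : PiPoset n S) ⋖ (x.move j t h).toLabeledPartition :=
  WithTop.coe_covBy_coe.2 ((apply_covBy_apply_iff (orderIso n S)).2 (covBy_move h))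

theorem coe_covBy_top_iff {x : NormalForm n S} :
    (x.toLabeledPartition : PiPoset n S) ⋖ ⊤ ↔ IsMax x := by
  rw [WithTop.coe_covBy_top, ← orderIso_apply, (orderIso n S).isMax_apply]

variable [Fintype S] [LinearOrder S]

theorem edgeLabeling_move {x : NormalForm n S} {j : Fin n} {t : Ground n ⊕ S}
    (h : x.IsTarget j t)
    (hc : (x.toLabeledPartition : PiPoset n S) ⋖ (x.move j t h).toLabeledPartition) :
    edgeLabeling n S _ _ hc = x.moveLabel j t :=
  label_move h

theorem edgeLabeling_top {x : LabeledPartition n S} (hc : (x : PiPoset n S) ⋖ ⊤) :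
    edgeLabeling n S _ _ hc = toLex (1, 2) := rfl

theorem isELLabeling_edgeLabeling : IsELLabeling (edgeLabeling n S) := by
  refine isELLabeling_of_local _ fun p q hpq => ?_
  obtain ⟨p, rfl⟩ := WithTop.ne_top_iff_exists.1 (hpq.trans_le le_top).ne
  obtain ⟨x, rfl⟩ := LabeledPartition.exists_toLabeledPartition_eq p
  obtain ⟨y, rfl⟩ := (orderIso n S).withTopCongr.surjective q
  have hcoe : ∀ z : NormalForm n S, (z.toLabeledPartition : PiPoset n S) =
    (orderIso n S).withTopCongr (z : WithTop (NormalForm n S)) := fun z => rfl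
  have hle : ∀ z : NormalForm n S, (z.toLabeledPartition : PiPoset n S) ≤
      (orderIso n S).withTopCongr y ↔ z ≤ y := fun z => by
    rw [hcoe, OrderIso.le_iff_le]
  have hxy : ↑x < y := by
    rwa [hcoe, OrderIso.lt_iff_lt] at hpq
  have hadm : ∀ z : NormalForm n S, ↑z ≤ y → ∀ w, (z.toLabeledPartition : PiPoset n S) ⋖ w →
      w ≤ (orderIso n S).withTopCongr y → (w = ⊤ ∧ y = ⊤ ∧ IsMax z) ∨
      ∃ j t, ∃ h : z.IsAdmissible y j t, w = (z.move j t h.1).toLabeledPartition := by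
    intro z hz w hw hwy
    by_cases hwt : w = ⊤
    · subst hwt
      refine .inl ⟨rfl, ?_, coe_covBy_top_iff.1 hw⟩
      rw [top_le_iff] at hwy
      exact (map_eq_top_iff (f := (orderIso n S).withTopCongr)).1 hwy
    · obtain ⟨j, t, h, rfl⟩ := exists_move_of_coe_covBy hw hwt
      exact .inr ⟨j, t, ⟨h, (coe_move_le_iff hz h).1 ((hle _).1 hwy)⟩, rfl⟩
  have hmove : ∀ z : NormalForm n S, ↑z ≤ y → ∀ j t (h : z.IsAdmissible y j t),
      ↑(z.move j t h.1) ≤ y := fun z hz j t h => (coe_move_le_iff hz h.1).2 h.2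
  by_cases hex : ∃ p : Fin n × (Ground n ⊕ S), x.IsAdmissible y p.1 p.2
  -- The distinguished atom is the admissible move of least label.
  · obtain ⟨⟨k, s⟩, hk, hmin'⟩ := Set.exists_min_image
      {p : Fin n × (Ground n ⊕ S) | x.IsAdmissible y p.1 p.2}
      (fun p => x.moveLabel p.1 p.2) (Set.toFinite _) hex
    have hmin : ∀ j t, x.IsAdmissible y j t → x.moveLabel k s ≤ x.moveLabel j t :=
      fun j t h => hmin' (j, t) h
    have hky := hmove x hxy.le k s hk
    refine ⟨_, coe_covBy_move hk.1, (hle _).2 hky, fun w hw hwy => ?_, fun z hz hzy hne => ?_⟩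
    · rw [edgeLabeling_move]
      rcases hadm _ hky w hw hwy with ⟨rfl, rfl, -⟩ | ⟨j, t, h, rfl⟩
      · exact moveLabel_lt_of_min_top hk hmin
      · rw [edgeLabeling_move]
        obtain ⟨h1, h2, -⟩ := (isAdmissible_move hk.1).1 h
        -- The next move was already admissible at `x`, where its label is strictly larger; the
        -- change of sign ranks preserves this.
        exact lt_moveLabel_move hk.1 (lt_moveLabel_of_ne hk hmin h1 fun e => h2 e.1)
    · rcases hadm x hxy.le z hz hzy with ⟨-, -, hmax⟩ | ⟨j, t, h, rfl⟩
      · exact absurd hk.1 (isMax_iff.1 hmax k s)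
      have hlt : x.moveLabel k s < x.moveLabel j t :=
        lt_moveLabel_of_ne hk hmin h (by rintro ⟨rfl, rfl⟩; exact hne rfl)
      refine ⟨by rwa [edgeLabeling_move, edgeLabeling_move], ?_⟩
      have hjy := hmove x hxy.le j t h
      rcases exists_isAdmissible_move_le hk hmin h hlt with ⟨l, r, hlr, hle'⟩ | ⟨rfl, hmax, hle'⟩
      · refine ⟨_, coe_covBy_move hlr.1, (hle _).2 (hmove _ hjy l r hlr), ?_⟩
        rwa [edgeLabeling_move, edgeLabeling_move]
      · refine ⟨⊤, coe_covBy_top_iff.2 hmax, le_of_eq (map_top _).symm, ?_⟩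
        rwa [edgeLabeling_move, edgeLabeling_top]
  -- Without admissible moves the interval is a single edge from a maximal labeled partition to the
  -- top.
  · have hy : y = ⊤ := by
      by_contra hy
      obtain ⟨y, rfl⟩ := WithTop.ne_top_iff_exists.1 hy
      obtain ⟨j, t, h, hjy⟩ := exists_move_le (WithTop.coe_lt_coe.1 hxy)
      exact hex ⟨(j, t), h, (coe_move_le_iff hxy.le h).1 (WithTop.coe_le_coe.2 hjy)⟩
    subst hy
    have hmax : IsMax x := isMax_iff.2 fun j t h => hex ⟨(j, t), h, Compat.top⟩
    refine ⟨⊤, coe_covBy_top_iff.2 hmax, le_of_eq (map_top _).symm,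
      fun w hw _ => absurd hw.lt not_top_lt, fun z hz hzy hne => ?_⟩
    rcases hadm x hxy.le z hz hzy with ⟨rfl, -, -⟩ | ⟨j, t, h, rfl⟩
    · exact absurd rfl hne
    · exact absurd ⟨(j, t), h⟩ hex

end Labeling

end LabeledPartitions

theorem mainTheorem2 (n : ℕ) (S : Type*) [Fintype S] [LinearOrder S] :
    LabeledPartitions.IsELLabeling (LabeledPartitions.edgeLabeling n S) :=
  LabeledPartitions.isELLabeling_edgeLabeling
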